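/- For $n\ge 1$ let $\Delta_n$ be the set of probability distributions on $[n]=\{1,\dots,n\}$. For $q_1,q_2\in\Delta_n$ put $\Pi_{q_1,q_2}=\{(1-\alpha)q_1+\alpha q_2:\alpha\in[0,1]\}$, and call $p\in\Delta_n$ *$\epsilon$-far* from $\Pi_{q_1,q_2}$ if $\|p-r\|_1\ge\epsilon$ for every $r\in\Pi_{q_1,q_2}$. A *closeness tester in the presence of noise accessible via samples*, with proximity parameter $\epsilon$, is a (possibly randomized) algorithm that receives $m_0$, $m_1$, $m_2$ independent samples from unknown distributions $p$, $q_1$, $q_2\in\Delta_n$ respectively and satisfies, for all $p,q_1,q_2\in\Delta_n$: if $p\in\Pi_{q_1,q_2}$ it accepts with probability at least $2/3$, and if $p$ is $\epsilon$-far from $\Pi_{q_1,q_2}$ it rejects with probability at least $2/3$. The number of samples it uses is $m_0+m_1+m_2$. The number of samples needed for this task is $\Theta\left(\sqrt n/\epsilon^2+n^{2/3}/\epsilon^{4/3}\right)$. Precisely, there are universal constants $c,C>0$ such that: (i) for all $n\ge1$ and $\epsilon>0$ there is such a tester that uses at most $C\left(\sqrt n/\epsilon^2+n^{2/3}/\epsilon^{4/3}\right)$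 samples; (ii) for all $n\ge2$ and $0<\epsilon\le1$, every such tester uses at least $c\left(\sqrt n/\epsilon^2+n^{2/3}/\epsilon^{4/3}\right)$ samples. -/

import Mathlib

namespace MixtureTesting

noncomputable section

/-- A probability distribution on a domain with `n` elements. -/
abbrev Dist (n : ℕ) : Type := stdSimplex ℝ (Fin n)

/-- The `ℓ₁`-distance between two distributions. -/
def l1Dist {n : ℕ} (p q : Dist n) : ℝ := ∑ i, |p.1 i - q.1 i|

/-- The set of all mixtures `(1 - α) q₁ + α q₂` with `α ∈ [0, 1]`. -/
def mixtures {n : ℕ} (q₁ q₂ : Dist n) : Set (Dist n) :=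
  {r | ∃ α : ℝ, 0 ≤ α ∧ α ≤ 1 ∧ ∀ i, r.1 i = (1 - α) * q₁.1 i + α * q₂.1 i}

/-- `p` is `ε`-far from every member of the property `P`. -/
def IsFar {n : ℕ} (ε : ℝ) (p : Dist n) (P : Set (Dist n)) : Prop :=
  ∀ r ∈ P, ε ≤ l1Dist p r

/-- The probability that `m` independent samples from `p` are exactly `x 0, …, x (m - 1)`. -/
def sampleProb {n m : ℕ} (p : Dist n) (x : Fin m → Fin n) : ℝ := ∏ j, p.1 (x j)

/-- A randomized algorithm which sees `m₀` samples from the first distribution, `m₁` from the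
second and `m₂` from the third, and then accepts or rejects; the value is the probability
(over the internal randomness) of accepting on the given samples. -/
abbrev Algorithm (n m₀ m₁ m₂ : ℕ) : Type :=
  (Fin m₀ → Fin n) → (Fin m₁ → Fin n) → (Fin m₂ → Fin n) → unitInterval

/-- The probability, over independent samples from `p`, `q₁`, `q₂` and the internal randomness,
that the algorithm accepts. -/
def acceptProb {n m₀ m₁ m₂ : ℕ} (T : Algorithm n m₀ m₁ m₂) (p q₁ q₂ : Dist n) : ℝ :=
  ∑ x : Fin m₀ → Fin n, ∑ y : Fin m₁ → Fin n, ∑ z : Fin m₂ → Fin n,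
    sampleProb p x * sampleProb q₁ y * sampleProb q₂ z * (T x y z : ℝ)

/-- The algorithm is a closeness tester in the presence of noise that is accessible via samples:
for all `p`, `q₁`, `q₂` it accepts with probability at least `2/3` if `p` is a mixture of `q₁` and
`q₂`, and rejects with probability at least `2/3` if `p` is `ε`-far from all such mixtures. -/
def IsMixtureTester {n m₀ m₁ m₂ : ℕ} (ε : ℝ) (T : Algorithm n m₀ m₁ m₂) : Prop :=
  ∀ p q₁ q₂ : Dist n,
    (p ∈ mixtures q₁ q₂ → 2 / 3 ≤ acceptProb T p q₁ q₂) ∧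
    (IsFar ε p (mixtures q₁ q₂) → 2 / 3 ≤ 1 - acceptProb T p q₁ q₂)

/-- The rate `√n / ε² + n^(2/3) / ε^(4/3)`. -/
def rate (n : ℕ) (ε : ℝ) : ℝ :=
  √(n : ℝ) / ε ^ 2 + (n : ℝ) ^ (2 / 3 : ℝ) / ε ^ (4 / 3 : ℝ)

end

end MixtureTesting

/-!
The tester first flattens the domain: each element is split into one bucket, plus one more for every
occurrence of it among a preliminary batch of samples, so that the `ℓ₂`-norms of the bucketed
distributions are small. Unbiased estimates, from two independent batches, of the weighted inner
products of `p - q₁` and `q₂ - q₁` then give an estimate of the squared `ℓ₂`-distance from `p` to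
`(1 - α) q₁ + α q₂`. It is a quadratic polynomial in `α`, so that controlling its coefficients
around the closest mixture by Chebyshev's inequality controls it along the whole segment.

Both lower bounds take `q₁ = q₂`. The term `√n / ε²` comes from testing uniformity: `m` samples from
a randomly perturbed uniform distribution have `χ²`-divergence at most `exp (m² ε⁴ / n) - 1` from
`m` samples from the uniform distribution. The term `n^(2/3) / ε^(4/3)` comes from random
distributions with a few heavy elements and many light ones, where the light elements either have
the same mass in `p` and `q₁`, or twice this mass in one of the two, chosen by a fair coin. After
Poissonisation the elements are independent; the first moments of both cases agree, and the
collisions at light elements that could tell them apart are masked by the heavy elements.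
-/

namespace MixtureTesting

section Expectation

variable {Ω Ω' ι : Type*} [Fintype Ω] [Fintype Ω']

/-- The expectation of `f` when the outcome `a` has probability `μ a`. Signed and unnormalised
weights are allowed, so that each lemma can assume exactly what it needs of `μ`. -/
def expect (μ f : Ω → ℝ) : ℝ := ∑ a, μ a * f a

open Classical in
/-- The probability of the event `E` when the outcome `a` has probability `μ a`. -/
noncomputable def prob (μ : Ω → ℝ) (E : Ω → Prop) : ℝ := expect μ fun a => if E a then 1 else 0

/-- The weights of a pair of independent outcomes. -/
def pairWeight (μ : Ω → ℝ) (ν : Ω' → ℝ) (x : Ω × Ω') : ℝ := μ x.1 * ν x.2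

/-- The weights of a family of independent outcomes. -/
def prodWeight [Fintype ι] (μ : ι → Ω → ℝ) (ω : ι → Ω) : ℝ := ∏ s, μ s (ω s)

/-- The weights of `m` independent outcomes with common weights `μ`. -/
def iidWeight (μ : Ω → ℝ) (m : ℕ) : (Fin m → Ω) → ℝ := prodWeight fun _ => μ

variable {μ : Ω → ℝ} {ν : Ω' → ℝ} {f g : Ω → ℝ}

theorem expect_add (μ f g : Ω → ℝ) :
    expect μ (fun a => f a + g a) = expect μ f + expect μ g := by
  simp only [expect, mul_add, Finset.sum_add_distrib]

theorem expect_sub (μ f g : Ω → ℝ) :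
    expect μ (fun a => f a - g a) = expect μ f - expect μ g := by
  simp only [expect, mul_sub, Finset.sum_sub_distrib]

theorem expect_const_mul (μ : Ω → ℝ) (c : ℝ) (f : Ω → ℝ) :
    expect μ (fun a => c * f a) = c * expect μ f := by
  simp only [expect, Finset.mul_sum, mul_left_comm]

theorem expect_mul_const (μ f : Ω → ℝ) (c : ℝ) :
    expect μ (fun a => f a * c) = expect μ f * c := by
  simp only [expect, Finset.sum_mul, mul_assoc]

theorem expect_sum {κ : Type*} (μ : Ω → ℝ) (s : Finset κ) (f : κ → Ω → ℝ) :
    expect μ (fun a => ∑ k ∈ s, f k a) = ∑ k ∈ s, expect μ (f k) := by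
  simp only [expect, Finset.mul_sum]
  exact Finset.sum_comm

theorem expect_const (hμ : ∑ a, μ a = 1) (c : ℝ) : expect μ (fun _ => c) = c := by
  rw [expect, ← Finset.sum_mul, hμ, one_mul]

theorem expect_mono (hμ : ∀ a, 0 ≤ μ a) (h : ∀ a, f a ≤ g a) : expect μ f ≤ expect μ g :=
  Finset.sum_le_sum fun a _ => mul_le_mul_of_nonneg_left (h a) (hμ a)

theorem expect_nonneg (hμ : ∀ a, 0 ≤ μ a) (hf : ∀ a, 0 ≤ f a) : 0 ≤ expect μ f :=
  Finset.sum_nonneg fun a _ => mul_nonneg (hμ a) (hf a)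

theorem expect_comm (μ : Ω → ℝ) (ν : Ω' → ℝ) (f : Ω → Ω' → ℝ) :
    expect μ (fun a => expect ν (f a)) = expect ν fun b => expect μ fun a => f a b := by
  simp only [expect, Finset.mul_sum, mul_left_comm]
  exact Finset.sum_comm

theorem expect_pairWeight (μ : Ω → ℝ) (ν : Ω' → ℝ) (f : Ω × Ω' → ℝ) :
    expect (pairWeight μ ν) f = expect μ fun a => expect ν fun b => f (a, b) := by
  simp only [expect, pairWeight, Fintype.sum_prod_type, Finset.mul_sum, mul_assoc]

theorem pairWeight_mem_stdSimplex (hμ : μ ∈ stdSimplex ℝ Ω) (hν : ν ∈ stdSimplex ℝ Ω') :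
    pairWeight μ ν ∈ stdSimplex ℝ (Ω × Ω') :=
  ⟨fun x => mul_nonneg (hμ.1 x.1) (hν.1 x.2), by
    simp only [pairWeight, Fintype.sum_prod_type, ← Finset.mul_sum, hν.2, mul_one, hμ.2]⟩

theorem expect_sq_sub_expect_le (hμ : ∑ a, μ a = 1) (f : Ω → ℝ) :
    expect μ (fun a => (f a - expect μ f) ^ 2) ≤ expect μ fun a => f a ^ 2 := by
  have hexpand : expect μ (fun a => (f a - expect μ f) ^ 2)
      = expect μ (fun a => f a ^ 2) - expect μ f ^ 2 := by
    simp only [sub_sq, expect_add, expect_sub, expect_mul_const, expect_const_mul, expect_const hμ]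
    ring
  linarith [sq_nonneg (expect μ f)]

theorem prob_le_one (hμ : μ ∈ stdSimplex ℝ Ω) (E : Ω → Prop) : prob μ E ≤ 1 := by
  refine (expect_mono hμ.1 fun a => ?_).trans_eq (expect_const hμ.2 1)
  split_ifs <;> norm_num

theorem prob_not (hμ : ∑ a, μ a = 1) (E : Ω → Prop) :
    prob μ (fun a => ¬ E a) = 1 - prob μ E := by
  classical
  rw [eq_sub_iff_add_eq, prob, prob, ← expect_add]
  refine Eq.trans ?_ (expect_const hμ 1)
  congr 1
  ext a
  by_cases h : E a <;> simp [h]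

theorem prob_mono (hμ : ∀ a, 0 ≤ μ a) {E F : Ω → Prop} (h : ∀ a, E a → F a) :
    prob μ E ≤ prob μ F := by
  refine expect_mono hμ fun a => ?_
  by_cases hE : E a
  · simp [hE, h a hE]
  · split_ifs <;> norm_num

theorem prob_or_le (hμ : ∀ a, 0 ≤ μ a) (E F : Ω → Prop) :
    prob μ (fun a => E a ∨ F a) ≤ prob μ E + prob μ F := by
  classical
  rw [prob, prob, prob, ← expect_add]
  refine expect_mono hμ fun a => ?_
  by_cases hE : E a <;> by_cases hF : F a <;> simp [hE, hF]

theorem mul_prob_le_expect (hμ : ∀ a, 0 ≤ μ a) (hf : ∀ a, 0 ≤ f a) (c : ℝ) :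
    c * prob μ (fun a => c ≤ f a) ≤ expect μ f := by
  classical
  rw [prob, ← expect_const_mul]
  refine expect_mono hμ fun a => ?_
  split_ifs with h
  · rwa [mul_one]
  · rw [mul_zero]; exact hf a

theorem expect_le_add_div (hμ : μ ∈ stdSimplex ℝ Ω) {b β c : ℝ} (hβ : 0 ≤ β) (hc : 0 < c)
    (hf : ∀ a, f a ≤ 1) (hg : ∀ a, 0 ≤ g a) (hgood : ∀ a, g a ≤ c → f a ≤ β)
    (hb : expect μ g ≤ b) : expect μ f ≤ β + b / c := by
  have hpoint : ∀ a, f a ≤ β + g a * c⁻¹ := fun a => by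
    rcases le_or_gt (g a) c with hle | hlt
    · linarith [hgood a hle, mul_nonneg (hg a) (inv_pos.2 hc).le]
    · have : 1 ≤ g a * c⁻¹ := by rw [← div_eq_mul_inv, one_le_div hc]; exact hlt.le
      linarith [hf a]
  calc expect μ f ≤ expect μ fun a => β + g a * c⁻¹ := expect_mono hμ.1 hpoint
    _ = β + expect μ g / c := by
        rw [expect_add, expect_const hμ.2, expect_mul_const, div_eq_mul_inv]
    _ ≤ β + b / c := by gcongr

end Expectation

section Independence

variable {Ω ι : Type*} [Fintype ι] {μ : ι → Ω → ℝ}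

theorem prodWeight_nonneg (hμ : ∀ s a, 0 ≤ μ s a) (ω : ι → Ω) : 0 ≤ prodWeight μ ω :=
  Finset.prod_nonneg fun s _ => hμ s (ω s)

variable [Fintype Ω]

theorem expect_prodWeight_prod [DecidableEq ι] (μ f : ι → Ω → ℝ) :
    expect (prodWeight μ) (fun ω => ∏ s, f s (ω s)) = ∏ s, expect (μ s) (f s) := by
  simp only [expect, prodWeight, ← Finset.prod_mul_distrib, Fintype.prod_sum]

theorem sum_prodWeight [DecidableEq ι] (hμ : ∀ s, ∑ a, μ s a = 1) : ∑ ω, prodWeight μ ω = 1 := by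
  simp only [prodWeight, ← Fintype.prod_sum, hμ, Finset.prod_const_one]

theorem prodWeight_mem_stdSimplex [DecidableEq ι] (hμ : ∀ s, μ s ∈ stdSimplex ℝ Ω) :
    prodWeight μ ∈ stdSimplex ℝ (ι → Ω) :=
  ⟨prodWeight_nonneg fun s => (hμ s).1, sum_prodWeight fun s => (hμ s).2⟩

theorem iidWeight_mem_stdSimplex {μ : Ω → ℝ} (hμ : μ ∈ stdSimplex ℝ Ω) (m : ℕ) :
    iidWeight μ m ∈ stdSimplex ℝ (Fin m → Ω) :=
  prodWeight_mem_stdSimplex fun _ => hμ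

theorem expect_prodWeight_apply [DecidableEq ι] (hμ : ∀ s, ∑ a, μ s a = 1) (s : ι) (g : Ω → ℝ) :
    expect (prodWeight μ) (fun ω => g (ω s)) = expect (μ s) g := by
  have hfactor : ∀ ω : ι → Ω, g (ω s) = ∏ r, (Pi.mulSingle s g : ι → Ω → ℝ) r (ω r) := by
    intro ω
    rw [Fintype.prod_eq_single s fun r hr => by simp [Pi.mulSingle_eq_of_ne hr],
      Pi.mulSingle_eq_same]
  simp only [hfactor, expect_prodWeight_prod]
  rw [Fintype.prod_eq_single s fun r hr => ?_, Pi.mulSingle_eq_same]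
  rw [Pi.mulSingle_eq_of_ne hr]
  exact expect_const (hμ r) 1

theorem expect_prodWeight_mul_apply [DecidableEq ι] (hμ : ∀ s, ∑ a, μ s a = 1) {s t : ι}
    (hst : s ≠ t) (g h : Ω → ℝ) :
    expect (prodWeight μ) (fun ω => g (ω s) * h (ω t)) = expect (μ s) g * expect (μ t) h := by
  set f : ι → Ω → ℝ := Function.update (Pi.mulSingle s g) t h with hf
  have hfs : f s = g := by simp [hf, hst]
  have hft : f t = h := by simp [hf]
  have hfr : ∀ r, r ≠ s ∧ r ≠ t → f r = fun _ => 1 := fun r hr => by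
    rw [hf, Function.update_of_ne hr.2, Pi.mulSingle_eq_of_ne hr.1]
    rfl
  have hfactor : ∀ ω : ι → Ω, g (ω s) * h (ω t) = ∏ r, f r (ω r) := fun ω => by
    rw [Fintype.prod_eq_mul s t hst fun r hr => by rw [hfr r hr], hfs, hft]
  simp only [hfactor, expect_prodWeight_prod]
  rw [Fintype.prod_eq_mul s t hst fun r hr => by rw [hfr r hr, expect_const (hμ r)], hfs, hft]

theorem expect_prodWeight_sq_sum_le [DecidableEq ι] (hμ : ∀ s, ∑ a, μ s a = 1)
    (g : ι → Ω → ℝ) :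
    expect (prodWeight μ) (fun ω => (∑ s, g s (ω s)) ^ 2)
      ≤ ∑ s, expect (μ s) (fun a => g s a ^ 2) + (∑ s, expect (μ s) (g s)) ^ 2 := by
  simp only [sq (Finset.sum _ _), Finset.sum_mul_sum, expect_sum, ← Finset.sum_add_distrib]
  refine Finset.sum_le_sum fun s _ => ?_
  rw [← Finset.add_sum_erase _ _ (Finset.mem_univ s),
    ← Finset.add_sum_erase _ (fun t => expect (μ s) (g s) * _) (Finset.mem_univ s), ← add_assoc]
  have hdiag : expect (prodWeight μ) (fun ω => g s (ω s) * g s (ω s))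
      = expect (μ s) (fun a => g s a ^ 2) := by
    simp only [sq]
    exact expect_prodWeight_apply hμ s fun a => g s a * g s a
  refine add_le_add (by linarith [mul_self_nonneg (expect (μ s) (g s))]) (Finset.sum_le_sum ?_)
  exact fun t ht =>
    (expect_prodWeight_mul_apply hμ (Finset.ne_of_mem_erase ht).symm (g s) (g t)).le

theorem expect_iidWeight_sq_sum_le {μ : Ω → ℝ} (hμ : ∑ a, μ a = 1) (g : Ω → ℝ) (m : ℕ) :
    expect (iidWeight μ m) (fun ω => (∑ j, g (ω j)) ^ 2)
      ≤ m * expect μ (fun a => g a ^ 2) + m ^ 2 * expect μ g ^ 2 := by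
  refine (expect_prodWeight_sq_sum_le (fun _ => hμ) fun _ => g).trans_eq ?_
  simp only [Finset.sum_const, Finset.card_univ, Fintype.card_fin, nsmul_eq_mul, mul_pow]

theorem expect_iidWeight_add (μ : Ω → ℝ) (k l : ℕ) (f : (Fin (k + l) → Ω) → ℝ) :
    expect (iidWeight μ (k + l)) f
      = expect (iidWeight μ k) fun x => expect (iidWeight μ l) fun y => f (Fin.append x y) := by
  rw [expect, ← (Fin.appendEquiv k l).sum_comp, Fintype.sum_prod_type]
  simp only [expect, Finset.mul_sum]
  refine Finset.sum_congr rfl fun x _ => Finset.sum_congr rfl fun y _ => ?_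
  have happend : Fin.appendEquiv k l (x, y) = Fin.append x y := rfl
  simp only [happend, iidWeight, prodWeight, Fin.prod_univ_add, Fin.append_left, Fin.append_right,
    mul_assoc]

end Independence

section BilinearStatistic

variable {Ω Ω' : Type*} [Fintype Ω] [Fintype Ω'] {μ : Ω → ℝ} {ν : Ω' → ℝ}

theorem expect_sq_bilinear_le (hμ : μ ∈ stdSimplex ℝ Ω) (hν : ν ∈ stdSimplex ℝ Ω')
    {K : Ω → Ω' → ℝ} (hK : expect μ (fun a => expect ν (K a)) = 0) (m l : ℕ) :
    expect (pairWeight (iidWeight μ m) (iidWeight ν l)) (fun x => (∑ j, ∑ k, K (x.1 j) (x.2 k)) ^ 2)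
      ≤ m * l * expect μ (fun a => expect ν fun b => K a b ^ 2)
        + m * l ^ 2 * expect μ (fun a => expect ν (K a) ^ 2)
        + m ^ 2 * l * expect ν fun b => expect μ (fun a => K a b) ^ 2 := by
  have hcol : expect ν (fun b => expect μ fun a => K a b) = 0 := by rw [expect_comm, hK]
  rw [expect_pairWeight, expect_comm]
  calc _ ≤ expect (iidWeight ν l) fun y => m * expect μ (fun a => (∑ k, K a (y k)) ^ 2)
          + m ^ 2 * (∑ k, expect μ fun a => K a (y k)) ^ 2 := by
        refine expect_mono (iidWeight_mem_stdSimplex hν l).1 fun y => ?_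
        rw [← expect_sum]
        exact expect_iidWeight_sq_sum_le hμ.2 (fun a => ∑ k, K a (y k)) m
    _ = m * expect μ (fun a => expect (iidWeight ν l) fun y => (∑ k, K a (y k)) ^ 2)
          + m ^ 2 * expect (iidWeight ν l) fun y => (∑ k, expect μ fun a => K a (y k)) ^ 2 := by
        rw [expect_add, expect_const_mul, expect_const_mul, expect_comm]
    _ ≤ m * expect μ (fun a => l * expect ν (fun b => K a b ^ 2) + l ^ 2 * expect ν (K a) ^ 2)
          + m ^ 2 * (l * expect ν (fun b => expect μ (fun a => K a b) ^ 2)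
            + l ^ 2 * expect ν (fun b => expect μ fun a => K a b) ^ 2) := by
        gcongr
        · exact expect_mono hμ.1 fun a => expect_iidWeight_sq_sum_le hν.2 (K a) l
        · exact expect_iidWeight_sq_sum_le hν.2 (fun b => expect μ fun a => K a b) l
    _ = _ := by
        rw [hcol, expect_add, expect_const_mul, expect_const_mul]
        ring

theorem variance_bilinear_le (hμ : μ ∈ stdSimplex ℝ Ω) (hν : ν ∈ stdSimplex ℝ Ω')
    (K : Ω → Ω' → ℝ) (m l : ℕ) :
    expect (pairWeight (iidWeight μ m) (iidWeight ν l)) (fun x =>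
        ((∑ j, ∑ k, K (x.1 j) (x.2 k)) - m * l * expect μ fun a => expect ν (K a)) ^ 2)
      ≤ m * l * expect μ (fun a => expect ν fun b => K a b ^ 2)
        + m * l ^ 2 * expect μ (fun a => expect ν (K a) ^ 2)
        + m ^ 2 * l * expect ν fun b => expect μ (fun a => K a b) ^ 2 := by
  set c := expect μ fun a => expect ν (K a) with hc
  have hcol : c = expect ν fun b => expect μ fun a => K a b := by rw [hc, expect_comm]
  have hcentered : expect μ (fun a => expect ν fun b => K a b - c) = 0 := by
    simp only [expect_sub, expect_const hμ.2, expect_const hν.2, ← hc, sub_self]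
  have hsum : ∀ x : (Fin m → Ω) × (Fin l → Ω'),
      (∑ j, ∑ k, K (x.1 j) (x.2 k)) - m * l * c = ∑ j, ∑ k, (K (x.1 j) (x.2 k) - c) := fun x => by
    simp only [Finset.sum_sub_distrib, Finset.sum_const, Finset.card_univ, Fintype.card_fin,
      nsmul_eq_mul]
    ring
  simp only [hsum]
  refine (expect_sq_bilinear_le hμ hν hcentered m l).trans ?_
  simp only [expect_sub, expect_const hμ.2, expect_const hν.2]
  gcongr
  · have h := expect_sq_sub_expect_le (pairWeight_mem_stdSimplex hμ hν).2 fun x => K x.1 x.2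
    simpa only [expect_pairWeight] using h
  · exact expect_sq_sub_expect_le hμ.2 fun a => expect ν (K a)
  · rw [hcol]
    exact expect_sq_sub_expect_le hν.2 fun b => expect μ fun a => K a b

end BilinearStatistic

section InverseCount

variable {Ω : Type*} [Fintype Ω] {μ : Ω → ℝ}

theorem expect_iidWeight_succ_apply (E : Ω → Prop) [DecidablePred E] (k : ℕ) (j₀ : Fin (k + 1)) :
    expect (iidWeight μ (k + 1)) (fun x =>
        (if E (x j₀) then 1 else 0) * (∑ j, if E (x j) then (1 : ℝ) else 0)⁻¹)
      = prob μ E * expect (iidWeight μ k)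
        (fun x => (1 + ∑ j, if E (x j) then (1 : ℝ) else 0)⁻¹) := by
  rw [expect, ← (Fin.insertNthEquiv (fun _ => Ω) j₀).sum_comp, Fintype.sum_prod_type, prob, expect,
    Finset.sum_mul]
  refine Finset.sum_congr rfl fun a _ => ?_
  rw [expect, Finset.mul_sum]
  refine Finset.sum_congr rfl fun x _ => ?_
  simp only [iidWeight, prodWeight, Fin.prod_univ_succAbove _ j₀, Fin.sum_univ_succAbove _ j₀]
  by_cases h : E a <;> simp [h, mul_assoc]

/-- By exchangeability, `k + 1` times the left-hand side is the probability that at least one of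
`k + 1` outcomes lies in `E`. -/
theorem prob_mul_expect_inv_one_add_count_le (hμ : μ ∈ stdSimplex ℝ Ω) (E : Ω → Prop)
    [DecidablePred E] (k : ℕ) :
    prob μ E * expect (iidWeight μ k) (fun x => (1 + ∑ j, if E (x j) then (1 : ℝ) else 0)⁻¹)
      ≤ 1 / (k + 1) := by
  have hw := iidWeight_mem_stdSimplex hμ (k + 1)
  rw [le_div_iff₀ (by positivity), mul_comm]
  calc _ = ∑ j₀ : Fin (k + 1), expect (iidWeight μ (k + 1)) (fun x =>
          (if E (x j₀) then 1 else 0) * (∑ j, if E (x j) then (1 : ℝ) else 0)⁻¹) := by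
        simp only [expect_iidWeight_succ_apply, Finset.sum_const, Finset.card_univ,
          Fintype.card_fin, nsmul_eq_mul, Nat.cast_add_one]
    _ ≤ expect (iidWeight μ (k + 1)) fun _ => 1 := by
        rw [← expect_sum]
        refine expect_mono hw.1 fun x => ?_
        rw [← Finset.sum_mul]
        exact mul_inv_le_one
    _ = 1 := expect_const hw.2 1

end InverseCount

section WeightedInner

variable {α : Type*} [Fintype α]

/-- The inner product on functions with weights `a`; the tester estimates the squared norm of
`p - r`, for `r` a mixture, in such an inner product. -/
def weightedInner (a u v : α → ℝ) : ℝ := ∑ i, a i * (u i * v i)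

theorem weightedInner_comm (a u v : α → ℝ) : weightedInner a u v = weightedInner a v u := by
  simp only [weightedInner, mul_comm (u _)]

theorem weightedInner_self_nonneg {a : α → ℝ} (ha : ∀ i, 0 ≤ a i) (u : α → ℝ) :
    0 ≤ weightedInner a u u :=
  Finset.sum_nonneg fun i _ => mul_nonneg (ha i) (mul_self_nonneg _)

theorem weightedInner_sub_smul (a u v w z : α → ℝ) (t : ℝ) :
    weightedInner a (u - t • v) (w - t • z)
      = weightedInner a u w - t * (weightedInner a u z + weightedInner a v w)
        + t ^ 2 * weightedInner a v z := by
  simp only [weightedInner, Pi.sub_apply, Pi.smul_apply, smul_eq_mul, Finset.mul_sum,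
    ← Finset.sum_add_distrib, ← Finset.sum_sub_distrib]
  exact Finset.sum_congr rfl fun i _ => by ring

theorem weightedInner_smul_sum {κ κ' : Type*} [Fintype κ] [Fintype κ'] (a : α → ℝ) (c c' : ℝ)
    (u : κ → α → ℝ) (v : κ' → α → ℝ) :
    weightedInner a (c • ∑ j, u j) (c' • ∑ k, v k)
      = c * c' * ∑ j, ∑ k, weightedInner a (u j) (v k) := by
  simp only [weightedInner]
  simp only [Finset.sum_comm (t := (Finset.univ : Finset α)), Pi.smul_apply, Finset.sum_apply,
    smul_eq_mul, ← Finset.mul_sum, ← Finset.sum_mul]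
  rw [Finset.mul_sum]
  exact Finset.sum_congr rfl fun i _ => by ring

theorem expect_weightedInner_left {Ω : Type*} [Fintype Ω] (μ : Ω → ℝ) (a : α → ℝ)
    (u : Ω → α → ℝ) (v : α → ℝ) :
    expect μ (fun ω => weightedInner a (u ω) v)
      = weightedInner a (fun i => expect μ fun ω => u ω i) v := by
  simp only [weightedInner, expect_sum, expect_const_mul, expect_mul_const]

theorem quadratic_growth_of_isMinOn {s : Set ℝ} (hs : Convex ℝ s) {A B C x y : ℝ}
    (hmin : IsMinOn (fun z => A - B * z + C * z ^ 2) s x) (hx : x ∈ s) (hy : y ∈ s) :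
    A - B * x + C * x ^ 2 + C * (y - x) ^ 2 ≤ A - B * y + C * y ^ 2 := by
  have hderiv : HasDerivAt (fun z : ℝ => A - B * z + C * z ^ 2) (-B + C * (2 * x)) x := by
    simpa using (((hasDerivAt_id' x).const_mul B).const_sub A).fun_add
      ((hasDerivAt_pow 2 x).const_mul C)
  have hfirst : 0 ≤ (y - x) * (-B + C * (2 * x)) := by
    simpa using hmin.localize.hasFDerivWithinAt_nonneg hderiv.hasFDerivAt.hasFDerivWithinAt
      (sub_mem_posTangentConeAt_of_segment_subset (hs.segment_subset hx hy))
  linarith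

theorem exists_weightedInner_growth_on_unitInterval (a u v : α → ℝ) :
    ∃ x ∈ Set.Icc (0 : ℝ) 1, ∀ y ∈ Set.Icc (0 : ℝ) 1,
      weightedInner a (u - x • v) (u - x • v) + (y - x) ^ 2 * weightedInner a v v
        ≤ weightedInner a (u - y • v) (u - y • v) := by
  set A := weightedInner a u u
  set B := weightedInner a u v + weightedInner a v u
  set C := weightedInner a v v
  have hexp (y : ℝ) : weightedInner a (u - y • v) (u - y • v) = A - B * y + C * y ^ 2 := by
    rw [weightedInner_sub_smul]; ring
  obtain ⟨x, hx, hmin⟩ := isCompact_Icc.exists_isMinOn (s := Set.Icc (0 : ℝ) 1)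
    (Set.nonempty_Icc.2 zero_le_one)
    (f := fun y => A - B * y + C * y ^ 2) (by fun_prop)
  refine ⟨x, hx, fun y hy => ?_⟩
  rw [hexp, hexp, mul_comm _ C]
  exact quadratic_growth_of_isMinOn (convex_Icc 0 1) hmin hx hy

end WeightedInner

section Statistic

variable {ι α : Type*} [Fintype ι]

/-- The linear combination with coefficients `γ` of the family `P` of functions. -/
def comb (P : ι → α → ℝ) (γ : ι → ℝ) (i : α) : ℝ := ∑ s, γ s * P s i

theorem comb_sub_smul (P : ι → α → ℝ) (γ δ : ι → ℝ) (t : ℝ) :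
    comb P (γ - t • δ) = comb P γ - t • comb P δ := by
  ext i
  simp only [comb, Pi.sub_apply, Pi.smul_apply, smul_eq_mul, Finset.mul_sum,
    ← Finset.sum_sub_distrib]
  exact Finset.sum_congr rfl fun s _ => by ring

theorem mul_apply_le_of_sum_mul_sum_sq_le [Fintype α] {P : ι → α → ℝ} {a : α → ℝ}
    (ha : ∀ i, 0 ≤ a i ∧ a i ≤ 1) {r : ℝ} (hr0 : 0 ≤ r)
    (hr : ∑ i, a i * ∑ s, P s i ^ 2 ≤ r ^ 2) (s : ι) (i : α) : P s i * a i ≤ r := by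
  refine le_of_sq_le_sq ?_ hr0
  have hsum_nonneg (i : α) : 0 ≤ a i * ∑ s, P s i ^ 2 :=
    mul_nonneg (ha i).1 (Finset.sum_nonneg fun _ _ => sq_nonneg _)
  calc (P s i * a i) ^ 2 = P s i ^ 2 * a i ^ 2 := mul_pow _ _ _
    _ ≤ P s i ^ 2 * a i := by
        gcongr
        exact pow_le_of_le_one (ha i).1 (ha i).2 two_ne_zero
    _ ≤ a i * ∑ s, P s i ^ 2 := by
        rw [mul_comm]
        exact mul_le_mul_of_nonneg_left (Finset.single_le_sum (f := fun s => P s i ^ 2)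
          (fun _ _ => sq_nonneg _) (Finset.mem_univ s)) (ha i).1
    _ ≤ ∑ i, a i * ∑ s, P s i ^ 2 := Finset.single_le_sum (f := fun i => a i * ∑ s, P s i ^ 2)
        (fun i _ => hsum_nonneg i) (Finset.mem_univ i)
    _ ≤ r ^ 2 := hr

variable [DecidableEq α]

/-- The point masses at the members of a tuple of samples, one from each distribution. -/
def pointMass (ω : ι → α) (s : ι) (i : α) : ℝ := if ω s = i then 1 else 0

/-- The empirical distributions of a batch of sample tuples. -/
noncomputable def empirical {m : ℕ} (B : Fin m → ι → α) (s : ι) (i : α) : ℝ :=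
  (m : ℝ)⁻¹ * ∑ j, pointMass (B j) s i

theorem comb_empirical {m : ℕ} (B : Fin m → ι → α) (γ : ι → ℝ) :
    comb (empirical B) γ = (m : ℝ)⁻¹ • ∑ j, comb (pointMass (B j)) γ := by
  ext i
  simp only [comb, empirical, Pi.smul_apply, Finset.sum_apply, smul_eq_mul, Finset.mul_sum]
  rw [Finset.sum_comm]
  exact Finset.sum_congr rfl fun j _ => Finset.sum_congr rfl fun s _ => by ring

variable [Fintype α]

/-- The unbiased estimate of `weightedInner a (comb P γ) (comb P δ)` from two independent
batches. -/
noncomputable def stat {m : ℕ} (a : α → ℝ) (γ δ : ι → ℝ) (B C : Fin m → ι → α) : ℝ :=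
  weightedInner a (comb (empirical B) γ) (comb (empirical C) δ)

/-- The contribution to `stat` of a single sample tuple from each batch. -/
def kern (a : α → ℝ) (γ δ : ι → ℝ) (ω ω' : ι → α) : ℝ :=
  weightedInner a (comb (pointMass ω) γ) (comb (pointMass ω') δ)

theorem stat_eq_sum_kern {m : ℕ} (a : α → ℝ) (γ δ : ι → ℝ) (B C : Fin m → ι → α) :
    stat a γ δ B C = (∑ j, ∑ k, kern a γ δ (B j) (C k)) / m ^ 2 := by
  simp only [stat, kern, comb_empirical, weightedInner_smul_sum]
  field_simp

theorem weightedInner_comb_pointMass (a : α → ℝ) (γ : ι → ℝ) (ω : ι → α) (v : α → ℝ) :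
    weightedInner a (comb (pointMass ω) γ) v = ∑ s, γ s * (a (ω s) * v (ω s)) := by
  simp only [weightedInner, comb, pointMass, Finset.sum_mul, Finset.mul_sum]
  rw [Finset.sum_comm]
  refine Finset.sum_congr rfl fun s _ => ?_
  simp only [mul_ite, ite_mul, mul_one, mul_zero, zero_mul, Finset.sum_ite_eq, Finset.mem_univ,
    if_true]
  ring

theorem kern_eq_sum (a : α → ℝ) (γ δ : ι → ℝ) (ω ω' : ι → α) :
    kern a γ δ ω ω' = ∑ s, ∑ t, γ s * δ t * (if ω' t = ω s then a (ω s) else 0) := by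
  simp only [kern, weightedInner_comb_pointMass, comb, pointMass, Finset.mul_sum]
  refine Finset.sum_congr rfl fun s _ => Finset.sum_congr rfl fun t _ => ?_
  split_ifs <;> ring

variable {a : α → ℝ} {γ δ : ι → ℝ}

theorem sq_kern_le (ha : ∀ i, 0 ≤ a i ∧ a i ≤ 1) (hγ : ∀ s, |γ s| ≤ 1) (hδ : ∀ s, |δ s| ≤ 1)
    (ω ω' : ι → α) :
    kern a γ δ ω ω' ^ 2
      ≤ Fintype.card ι ^ 2 * ∑ s, ∑ t, if ω' t = ω s then a (ω s) else 0 := by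
  have hterm (s t : ι) : (γ s * δ t * if ω' t = ω s then a (ω s) else 0) ^ 2
      ≤ if ω' t = ω s then a (ω s) else 0 := by
    have hcoef : (γ s * δ t) ^ 2 ≤ 1 := by
      rw [sq_le_one_iff_abs_le_one, abs_mul]
      exact mul_le_one₀ (hγ s) (abs_nonneg _) (hδ t)
    obtain ⟨ha0, ha1⟩ := ha (ω s)
    split_ifs
    · calc (γ s * δ t * a (ω s)) ^ 2 = (γ s * δ t) ^ 2 * a (ω s) ^ 2 := mul_pow _ _ _
        _ ≤ 1 * a (ω s) ^ 2 := by gcongr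
        _ ≤ a (ω s) := by nlinarith
    · simp
  rw [kern_eq_sum]
  simp only [← Fintype.sum_prod_type']
  refine (sq_sum_le_card_mul_sum_sq ..).trans ?_
  rw [Finset.card_univ, Fintype.card_prod, Nat.cast_mul, ← sq]
  gcongr with x
  exact hterm x.1 x.2

variable [DecidableEq ι] {P : ι → α → ℝ}

theorem expect_comb_pointMass (hP : ∀ s, ∑ i, P s i = 1) (γ : ι → ℝ) (i : α) :
    expect (prodWeight P) (fun ω => comb (pointMass ω) γ i) = comb P γ i := by
  simp only [comb, expect_sum, expect_const_mul]
  refine Finset.sum_congr rfl fun s _ => ?_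
  rw [show (fun ω : ι → α => pointMass ω s i) = fun ω => if ω s = i then (1 : ℝ) else 0 from rfl,
    expect_prodWeight_apply hP s fun j => if j = i then (1 : ℝ) else 0]
  simp [expect]

theorem expect_kern_left (hP : ∀ s, ∑ i, P s i = 1) (ω' : ι → α) :
    expect (prodWeight P) (fun ω => kern a γ δ ω ω')
      = weightedInner a (comb (pointMass ω') δ) (comb P γ) := by
  simp only [kern, expect_weightedInner_left, expect_comb_pointMass hP]
  exact weightedInner_comm _ _ _

theorem expect_kern_right (hP : ∀ s, ∑ i, P s i = 1) (ω : ι → α) :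
    expect (prodWeight P) (fun ω' => kern a γ δ ω ω')
      = weightedInner a (comb (pointMass ω) γ) (comb P δ) := by
  simpa only [kern, weightedInner_comm a (comb (pointMass ω) γ) (comb (pointMass _) δ)]
    using expect_kern_left (γ := δ) (δ := γ) hP ω

theorem expect_expect_kern (hP : ∀ s, ∑ i, P s i = 1) :
    expect (prodWeight P) (fun ω => expect (prodWeight P) fun ω' => kern a γ δ ω ω')
      = weightedInner a (comb P γ) (comb P δ) := by
  simp only [expect_kern_right hP, expect_weightedInner_left, expect_comb_pointMass hP]

theorem expect_sq_kern_le (hP : ∀ s, P s ∈ stdSimplex ℝ α) (ha : ∀ i, 0 ≤ a i ∧ a i ≤ 1)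
    (hγ : ∀ s, |γ s| ≤ 1) (hδ : ∀ s, |δ s| ≤ 1) :
    expect (prodWeight P) (fun ω => expect (prodWeight P) fun ω' => kern a γ δ ω ω' ^ 2)
      ≤ Fintype.card ι ^ 3 * ∑ i, a i * ∑ s, P s i ^ 2 := by
  have hP0 := prodWeight_nonneg fun s => (hP s).1
  have hcoll (s t : ι) : (expect (prodWeight P) fun ω => expect (prodWeight P) fun ω' =>
      if ω' t = ω s then a (ω s) else 0) = ∑ i, a i * (P s i * P t i) := by
    have hinner (i : α) : expect (prodWeight P) (fun ω' => if ω' t = i then a i else 0)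
        = P t i * a i := by
      rw [expect_prodWeight_apply (fun s => (hP s).2) t fun j => if j = i then a i else 0]
      simp [expect]
    simp only [hinner]
    rw [expect_prodWeight_apply (fun s => (hP s).2) s fun i => P t i * a i]
    exact Finset.sum_congr rfl fun i _ => by ring
  calc _ ≤ expect (prodWeight P) (fun ω => expect (prodWeight P) fun ω' =>
          (Fintype.card ι : ℝ) ^ 2 * ∑ s, ∑ t, if ω' t = ω s then a (ω s) else 0) :=
        expect_mono hP0 fun ω => expect_mono hP0 fun ω' => sq_kern_le ha hγ hδ ω ω'
    _ = Fintype.card ι ^ 2 * ∑ i, a i * (∑ s, P s i) ^ 2 := by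
        simp only [expect_const_mul, expect_sum, hcoll, ← Finset.mul_sum,
          Finset.sum_comm (t := (Finset.univ : Finset α)), sq (∑ s, P s _), Finset.sum_mul_sum]
    _ ≤ Fintype.card ι ^ 2 * ∑ i, a i * (Fintype.card ι * ∑ s, P s i ^ 2) := by
        gcongr with i
        · exact (ha i).1
        · simpa using sq_sum_le_card_mul_sum_sq (s := Finset.univ) (f := fun s => P s i)
    _ = _ := by
        simp only [mul_left_comm (a _), ← Finset.mul_sum]
        ring

theorem expect_sq_weightedInner_comb_pointMass_le (hP : ∀ s, P s ∈ stdSimplex ℝ α)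
    (ha : ∀ i, 0 ≤ a i) (hγ : ∀ s, |γ s| ≤ 1) {r : ℝ} (hr : ∀ s i, P s i * a i ≤ r) (v : α → ℝ) :
    expect (prodWeight P) (fun ω => weightedInner a (comb (pointMass ω) γ) v ^ 2)
      ≤ Fintype.card ι ^ 2 * r * weightedInner a v v := by
  have hpoint (ω : ι → α) : weightedInner a (comb (pointMass ω) γ) v ^ 2
      ≤ Fintype.card ι * ∑ s, (a (ω s) * v (ω s)) ^ 2 := by
    rw [weightedInner_comb_pointMass]
    refine (sq_sum_le_card_mul_sum_sq ..).trans ?_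
    rw [Finset.card_univ]
    refine mul_le_mul_of_nonneg_left (Finset.sum_le_sum fun s _ => ?_) (Nat.cast_nonneg _)
    rw [mul_pow]
    exact mul_le_of_le_one_left (sq_nonneg _) ((sq_le_one_iff_abs_le_one _).2 (hγ s))
  calc _ ≤ expect (prodWeight P) fun ω => Fintype.card ι * ∑ s, (a (ω s) * v (ω s)) ^ 2 :=
        expect_mono (prodWeight_nonneg fun s => (hP s).1) hpoint
    _ = Fintype.card ι * ∑ s, ∑ i, P s i * (a i * v i) ^ 2 := by
        rw [expect_const_mul, expect_sum]
        congr 1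
        exact Finset.sum_congr rfl fun s _ =>
          expect_prodWeight_apply (fun s => (hP s).2) s fun i => (a i * v i) ^ 2
    _ ≤ Fintype.card ι * ∑ _s : ι, ∑ i, r * (a i * (v i * v i)) := by
        refine mul_le_mul_of_nonneg_left (Finset.sum_le_sum fun s _ =>
          Finset.sum_le_sum fun i _ => ?_) (Nat.cast_nonneg _)
        have := mul_le_mul_of_nonneg_right (hr s i) (mul_nonneg (ha i) (mul_self_nonneg (v i)))
        linarith
    _ = _ := by
        simp only [← Finset.mul_sum, Finset.sum_const, Finset.card_univ, nsmul_eq_mul,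
          weightedInner]
        ring

theorem variance_stat_le (hP : ∀ s, P s ∈ stdSimplex ℝ α) (ha : ∀ i, 0 ≤ a i ∧ a i ≤ 1)
    (hγ : ∀ s, |γ s| ≤ 1) (hδ : ∀ s, |δ s| ≤ 1) {r : ℝ} (hr0 : 0 ≤ r)
    (hr : ∑ i, a i * ∑ s, P s i ^ 2 ≤ r ^ 2) {m : ℕ} (hm : m ≠ 0) :
    expect (pairWeight (iidWeight (prodWeight P) m) (iidWeight (prodWeight P) m)) (fun x =>
        (stat a γ δ x.1 x.2 - weightedInner a (comb P γ) (comb P δ)) ^ 2)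
      ≤ Fintype.card ι ^ 3 * (r / m) ^ 2 + Fintype.card ι ^ 2 * (r / m) *
        (weightedInner a (comb P γ) (comb P γ) + weightedInner a (comb P δ) (comb P δ)) := by
  have hm0 : (m : ℝ) ≠ 0 := Nat.cast_ne_zero.2 hm
  have hprod := prodWeight_mem_stdSimplex hP
  have hsum := fun s => (hP s).2
  have hPr := mul_apply_le_of_sum_mul_sum_sq_le ha hr0 hr
  have hscale (x : (Fin m → ι → α) × (Fin m → ι → α)) :
      (stat a γ δ x.1 x.2 - weightedInner a (comb P γ) (comb P δ)) ^ 2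
        = ((m : ℝ) ^ 4)⁻¹ * ((∑ j, ∑ k, kern a γ δ (x.1 j) (x.2 k))
          - m * m * weightedInner a (comb P γ) (comb P δ)) ^ 2 := by
    rw [stat_eq_sum_kern]
    field_simp
  have hvar := variance_bilinear_le hprod hprod (kern a γ δ) m m
  rw [expect_expect_kern hsum] at hvar
  simp only [expect_kern_right hsum, expect_kern_left hsum] at hvar
  simp only [hscale, expect_const_mul]
  calc _ ≤ ((m : ℝ) ^ 4)⁻¹ * (m * m * (Fintype.card ι ^ 3 * r ^ 2)
          + m * m ^ 2 * (Fintype.card ι ^ 2 * r * weightedInner a (comb P δ) (comb P δ))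
          + m ^ 2 * m * (Fintype.card ι ^ 2 * r * weightedInner a (comb P γ) (comb P γ))) := by
        gcongr
        refine hvar.trans ?_
        gcongr
        · exact (expect_sq_kern_le hP ha hγ hδ).trans (by gcongr)
        · exact expect_sq_weightedInner_comb_pointMass_le hP (fun i => (ha i).1) hγ hPr _
        · exact expect_sq_weightedInner_comb_pointMass_le hP (fun i => (ha i).1) hδ hPr _
    _ = _ := by field_simp; ring

end Statistic

section Decision

variable {α : Type*}

/-- The coefficients of `p - ((1 - x) q₁ + x q₂)` with respect to `p`, `q₁`, `q₂`. -/
def mixVec (x : ℝ) : Fin 3 → ℝ := ![1, -(1 - x), -x]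

/-- The coefficients of `q₂ - q₁` with respect to `p`, `q₁`, `q₂`. -/
def dirVec : Fin 3 → ℝ := ![0, -1, 1]

theorem mixVec_eq_sub_smul (x y : ℝ) : mixVec y = mixVec x - (y - x) • dirVec := by
  ext s
  fin_cases s <;> simp [mixVec, dirVec]
  ring

theorem abs_mixVec_le {x : ℝ} (hx : x ∈ Set.Icc (0 : ℝ) 1) (s : Fin 3) : |mixVec x s| ≤ 1 := by
  obtain ⟨h0, h1⟩ := hx
  fin_cases s <;> simp [mixVec, abs_le] <;> constructor <;> linarith

theorem abs_dirVec_le (s : Fin 3) : |dirVec s| ≤ 1 := by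
  fin_cases s <;> simp [dirVec]

theorem comb_mixVec_eq_sub_smul (P : Fin 3 → α → ℝ) (x y : ℝ) :
    comb P (mixVec y) = comb P (mixVec x) - (y - x) • comb P dirVec := by
  rw [mixVec_eq_sub_smul x y, comb_sub_smul]

variable [Fintype α]

theorem exists_closest_mixture (a : α → ℝ) (P : Fin 3 → α → ℝ) :
    ∃ x ∈ Set.Icc (0 : ℝ) 1, ∀ y ∈ Set.Icc (0 : ℝ) 1,
      weightedInner a (comb P (mixVec x)) (comb P (mixVec x))
          + (y - x) ^ 2 * weightedInner a (comb P dirVec) (comb P dirVec)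
        ≤ weightedInner a (comb P (mixVec y)) (comb P (mixVec y)) := by
  have hcomb (y : ℝ) : comb P (mixVec y) = comb P (mixVec 0) - y • comb P dirVec := by
    rw [comb_mixVec_eq_sub_smul P 0 y, sub_zero]
  obtain ⟨x, hx, hgrowth⟩ :=
    exists_weightedInner_growth_on_unitInterval a (comb P (mixVec 0)) (comb P dirVec)
  refine ⟨x, hx, fun y hy => ?_⟩
  rw [hcomb x, hcomb y]
  exact hgrowth y hy

theorem abs_mul_le_of_sq_le {κ Q s D Z : ℝ} (hκ0 : 0 ≤ κ) (hκ : κ ≤ Q / 40000) (hs : s ^ 2 ≤ 1)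
    (hZ : s ^ 2 * Z ≤ 2 * Q) (hD : D ^ 2 ≤ 20 * (27 * κ ^ 2 + 9 * κ * Z)) :
    |s * D| ≤ Q / 10 := by
  have hQ : 0 ≤ Q := by linarith
  refine abs_le_of_sq_le_sq ?_ (by linarith)
  calc (s * D) ^ 2 = s ^ 2 * D ^ 2 := mul_pow _ _ _
    _ ≤ s ^ 2 * (20 * (27 * κ ^ 2 + 9 * κ * Z)) := by gcongr
    _ = 540 * (s ^ 2 * κ ^ 2) + 180 * κ * (s ^ 2 * Z) := by ring
    _ ≤ 540 * (1 * (Q / 40000) ^ 2) + 180 * κ * (2 * Q) := by gcongr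
    _ ≤ 540 * (1 * (Q / 40000) ^ 2) + 180 * (Q / 40000) * (2 * Q) := by gcongr
    _ ≤ (Q / 10) ^ 2 := by nlinarith [sq_nonneg Q]

variable [DecidableEq α] {a : α → ℝ} {P : Fin 3 → α → ℝ} {m : ℕ}

/-- The decision of the tester: some mixture is estimated to be close to `p`. -/
def Accepts (a : α → ℝ) (h : ℝ) (B C : Fin m → Fin 3 → α) : Prop :=
  ∃ x ∈ Set.Icc (0 : ℝ) 1, stat a (mixVec x) (mixVec x) B C ≤ h / 2

/-- The bound on the deviation of `stat` which Chebyshev's inequality provides with probability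
`19/20`; here `κ` is the noise level `r / m` of `variance_stat_le`. -/
def Typical (a : α → ℝ) (P : Fin 3 → α → ℝ) (κ : ℝ) (γ δ : Fin 3 → ℝ)
    (B C : Fin m → Fin 3 → α) : Prop :=
  (stat a γ δ B C - weightedInner a (comb P γ) (comb P δ)) ^ 2
    < 20 * (27 * κ ^ 2 + 9 * κ * (weightedInner a (comb P γ) (comb P γ)
      + weightedInner a (comb P δ) (comb P δ)))

/-- The estimate is a quadratic polynomial in the mixing parameter, so controlling its coefficients
at the closest mixture controls it along the whole segment. -/
theorem not_accepts_of_typical (ha : ∀ i, 0 ≤ a i) {h κ x : ℝ} (hκ0 : 0 ≤ κ)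
    (hκ : κ ≤ h / 40000) (hh : 0 < h) (hx : x ∈ Set.Icc (0 : ℝ) 1)
    (hfar : h ≤ weightedInner a (comb P (mixVec x)) (comb P (mixVec x)))
    {B C : Fin m → Fin 3 → α} (hww : Typical a P κ (mixVec x) (mixVec x) B C)
    (hwd : Typical a P κ (mixVec x) dirVec B C) (hdw : Typical a P κ dirVec (mixVec x) B C)
    (hdd : Typical a P κ dirVec dirVec B C)
    (hgrowth : ∀ y ∈ Set.Icc (0 : ℝ) 1,
      weightedInner a (comb P (mixVec x)) (comb P (mixVec x))
          + (y - x) ^ 2 * weightedInner a (comb P dirVec) (comb P dirVec)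
        ≤ weightedInner a (comb P (mixVec y)) (comb P (mixVec y))) :
    ¬ Accepts a h B C := by
  rintro ⟨y, hy, hacc⟩
  have hq := hgrowth y hy
  rw [stat, comb_mixVec_eq_sub_smul (empirical B) x y, comb_mixVec_eq_sub_smul (empirical C) x y,
    weightedInner_sub_smul] at hacc
  rw [comb_mixVec_eq_sub_smul P x y, weightedInner_sub_smul] at hq
  simp only [Typical, stat] at hww hwd hdw hdd
  have ht : (y - x) ^ 2 ≤ 1 := by
    obtain ⟨⟨hx0, hx1⟩, hy0, hy1⟩ := And.intro hx hy
    rw [sq_le_one_iff_abs_le_one, abs_le]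
    constructor <;> linarith
  have hU : 0 ≤ weightedInner a (comb P dirVec) (comb P dirVec) := weightedInner_self_nonneg ha _
  set t := y - x
  set W := weightedInner a (comb P (mixVec x)) (comb P (mixVec x))
  set U := weightedInner a (comb P dirVec) (comb P dirVec)
  set Q := W + t ^ 2 * U
  have htU : 0 ≤ t ^ 2 * U := by positivity
  have hκQ : κ ≤ Q / 40000 := by linarith
  have htW : t ^ 2 * W ≤ W := mul_le_of_le_one_left (by linarith) ht
  have ht4 : (t ^ 2) ^ 2 ≤ t ^ 2 := pow_le_of_le_one (sq_nonneg t) ht two_ne_zero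
  have htU4 : (t ^ 2) ^ 2 * U ≤ t ^ 2 * U := mul_le_mul_of_nonneg_right ht4 hU
  have eww := abs_le.1 <| abs_mul_le_of_sq_le (s := 1) hκ0 hκQ (by norm_num) (by linarith) hww.le
  have ewd := abs_le.1 <| abs_mul_le_of_sq_le (s := t) hκ0 hκQ ht (by linarith) hwd.le
  have edw := abs_le.1 <| abs_mul_le_of_sq_le (s := t) hκ0 hκQ ht (by linarith) hdw.le
  have edd := abs_le.1 <|
    abs_mul_le_of_sq_le (s := t ^ 2) hκ0 hκQ (by linarith) (by linarith) hdd.le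
  linarith [eww.1, ewd.2, edw.2, edd.1]

theorem prob_not_typical_le (hP : ∀ s, P s ∈ stdSimplex ℝ α) (ha : ∀ i, 0 ≤ a i ∧ a i ≤ 1)
    {γ δ : Fin 3 → ℝ} (hγ : ∀ s, |γ s| ≤ 1) (hδ : ∀ s, |δ s| ≤ 1) {r : ℝ} (hr0 : 0 < r)
    (hr : ∑ i, a i * ∑ s, P s i ^ 2 ≤ r ^ 2) (hm : m ≠ 0) :
    prob (pairWeight (iidWeight (prodWeight P) m) (iidWeight (prodWeight P) m))
      (fun x => ¬ Typical a P (r / m) γ δ x.1 x.2) ≤ 1 / 20 := by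
  have hprod := iidWeight_mem_stdSimplex (prodWeight_mem_stdSimplex hP) m
  have hγγ := weightedInner_self_nonneg (fun i => (ha i).1) (comb P γ)
  have hδδ := weightedInner_self_nonneg (fun i => (ha i).1) (comb P δ)
  have hvar := variance_stat_le hP ha hγ hδ hr0.le hr hm
  have hmarkov := (mul_prob_le_expect (pairWeight_mem_stdSimplex hprod hprod).1
    (fun _ => sq_nonneg _) (20 * (27 * (r / m) ^ 2 + 9 * (r / m) *
      (weightedInner a (comb P γ) (comb P γ) + weightedInner a (comb P δ) (comb P δ))))).trans hvar
  simp only [Typical, not_lt]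
  refine le_of_mul_le_mul_left (hmarkov.trans_eq ?_) (by positivity)
  rw [Fintype.card_fin]
  ring

theorem prob_not_accepts_le (hP : ∀ s, P s ∈ stdSimplex ℝ α) (ha : ∀ i, 0 ≤ a i ∧ a i ≤ 1)
    {r h : ℝ} (hr0 : 0 ≤ r) (hr : ∑ i, a i * ∑ s, P s i ^ 2 ≤ r ^ 2) (hm : m ≠ 0) (hh : 0 < h)
    (hκ : r / m ≤ h / 40000) {x : ℝ} (hx : x ∈ Set.Icc (0 : ℝ) 1)
    (hmix : comb P (mixVec x) = 0) :
    prob (pairWeight (iidWeight (prodWeight P) m) (iidWeight (prodWeight P) m))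
      (fun x => ¬ Accepts a h x.1 x.2) ≤ 1 / 5 := by
  have hprod := iidWeight_mem_stdSimplex (prodWeight_mem_stdSimplex hP) m
  have hpair := pairWeight_mem_stdSimplex hprod hprod
  have hvar := variance_stat_le hP ha (abs_mixVec_le hx) (abs_mixVec_le hx) hr0 hr hm
  have hzero : weightedInner a (comb P (mixVec x)) (comb P (mixVec x)) = 0 := by
    simp [hmix, weightedInner]
  simp only [hzero, sub_zero, add_zero, mul_zero, Fintype.card_fin] at hvar
  have hmarkov := (mul_prob_le_expect hpair.1 (fun _ => sq_nonneg _) ((h / 2) ^ 2)).trans hvar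
  have hκsq : (r / m) ^ 2 ≤ (h / 40000) ^ 2 := by gcongr
  refine (prob_mono hpair.1 fun B hB => ?_).trans
    (le_of_mul_le_mul_left (hmarkov.trans (?_ : _ ≤ (h / 2) ^ 2 * (1 / 5))) (by positivity))
  · have hlt : h / 2 < stat a (mixVec x) (mixVec x) B.1 B.2 :=
      not_le.1 fun hle => hB ⟨x, hx, hle⟩
    gcongr
  · push_cast
    linarith [sq_nonneg h]

theorem prob_accepts_le (hP : ∀ s, P s ∈ stdSimplex ℝ α) (ha : ∀ i, 0 ≤ a i ∧ a i ≤ 1)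
    {r h : ℝ} (hr0 : 0 < r) (hr : ∑ i, a i * ∑ s, P s i ^ 2 ≤ r ^ 2) (hm : m ≠ 0)
    (hκ : r / m ≤ h / 40000)
    (hfar : ∀ x ∈ Set.Icc (0 : ℝ) 1,
      h ≤ weightedInner a (comb P (mixVec x)) (comb P (mixVec x))) :
    prob (pairWeight (iidWeight (prodWeight P) m) (iidWeight (prodWeight P) m))
      (fun x => Accepts a h x.1 x.2) ≤ 1 / 5 := by
  obtain ⟨x, hx, hgrowth⟩ := exists_closest_mixture a P
  have hprod := iidWeight_mem_stdSimplex (prodWeight_mem_stdSimplex hP) m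
  have hμ := (pairWeight_mem_stdSimplex hprod hprod).1
  have hκ0 : 0 < r / m := by positivity
  have hw := abs_mixVec_le hx
  have hunion : ∀ B : (Fin m → Fin 3 → α) × (Fin m → Fin 3 → α), Accepts a h B.1 B.2 →
      (¬ Typical a P (r / m) (mixVec x) (mixVec x) B.1 B.2 ∨
        ¬ Typical a P (r / m) (mixVec x) dirVec B.1 B.2) ∨
      ¬ Typical a P (r / m) dirVec (mixVec x) B.1 B.2 ∨
        ¬ Typical a P (r / m) dirVec dirVec B.1 B.2 := by
    intro B hB
    by_contra! hall
    obtain ⟨⟨hww, hwd⟩, hdw, hdd⟩ := hall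
    exact not_accepts_of_typical (fun i => (ha i).1) hκ0.le hκ (by linarith) hx (hfar x hx)
      hww hwd hdw hdd hgrowth hB
  have hsplit := (prob_mono hμ hunion).trans (prob_or_le hμ _ _)
  linarith [prob_or_le hμ (fun B => ¬ Typical a P (r / m) (mixVec x) (mixVec x) B.1 B.2)
      fun B => ¬ Typical a P (r / m) (mixVec x) dirVec B.1 B.2,
    prob_or_le hμ (fun B => ¬ Typical a P (r / m) dirVec (mixVec x) B.1 B.2)
      fun B => ¬ Typical a P (r / m) dirVec dirVec B.1 B.2,
    prob_not_typical_le hP ha hw hw hr0 hr hm, prob_not_typical_le hP ha hw abs_dirVec_le hr0 hr hm,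
    prob_not_typical_le hP ha abs_dirVec_le hw hr0 hr hm,
    prob_not_typical_le hP ha abs_dirVec_le abs_dirVec_le hr0 hr hm]

end Decision

section Flattening

theorem sq_sum_abs_le_sum_mul_weightedInner_inv {α : Type*} [Fintype α] {b : α → ℝ}
    (hb : ∀ i, 0 < b i) (u : α → ℝ) :
    (∑ i, |u i|) ^ 2 ≤ (∑ i, b i) * weightedInner (fun i => (b i)⁻¹) u u :=
  Finset.sum_sq_le_sum_mul_sum_of_sq_le_mul _ (fun i _ => (hb i).le)
    (fun i _ => mul_nonneg (inv_nonneg.2 (hb i).le) (mul_self_nonneg _)) fun i _ => by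
      rw [sq_abs, mul_inv_cancel_left₀ (hb i).ne', sq]

variable {ι α : Type*} [Fintype ι] [DecidableEq α] {k : ℕ}

/-- The number of buckets into which the flattening reduction splits each element: one, plus one
for every occurrence of the element among the sample tuples `A`. -/
def buckets (A : Fin k → ι → α) (i : α) : ℝ := 1 + ∑ j, ∑ s, if A j s = i then 1 else 0

theorem one_le_buckets (A : Fin k → ι → α) (i : α) : 1 ≤ buckets A i :=
  le_add_of_nonneg_right <| Finset.sum_nonneg fun _ _ => Finset.sum_nonneg fun _ _ => by
    split_ifs <;> norm_num

theorem inv_buckets_mem_unitInterval (A : Fin k → ι → α) (i : α) :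
    0 ≤ (buckets A i)⁻¹ ∧ (buckets A i)⁻¹ ≤ 1 :=
  ⟨inv_nonneg.2 (zero_le_one.trans (one_le_buckets A i)),
    inv_le_one_of_one_le₀ (one_le_buckets A i)⟩

variable [Fintype α]

theorem sum_buckets (A : Fin k → ι → α) :
    ∑ i, buckets A i = Fintype.card α + Fintype.card ι * k := by
  simp only [buckets, Finset.sum_add_distrib, Finset.sum_comm (s := (Finset.univ : Finset α)),
    Finset.sum_ite_eq, Finset.mem_univ, if_true, Finset.sum_const, Finset.card_univ,
    Fintype.card_fin, nsmul_eq_mul, mul_one]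
  ring

variable [DecidableEq ι] {P : ι → α → ℝ}

theorem mul_expect_inv_buckets_le (hP : ∀ s, P s ∈ stdSimplex ℝ α) (k : ℕ) (s : ι) (i : α) :
    P s i * expect (iidWeight (prodWeight P) k) (fun A => (buckets A i)⁻¹) ≤ 1 / (k + 1) := by
  have hmem := prodWeight_mem_stdSimplex hP
  have hprob : prob (prodWeight P) (fun ω => ω s = i) = P s i := by
    classical
    refine (expect_prodWeight_apply (fun s => (hP s).2) s
      fun j => @ite _ (j = i) (Classical.propDecidable _) (1 : ℝ) 0).trans ?_
    simp [expect]
  have h := prob_mul_expect_inv_one_add_count_le hmem (fun ω => ω s = i) k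
  rw [hprob] at h
  refine (mul_le_mul_of_nonneg_left (expect_mono (iidWeight_mem_stdSimplex hmem k).1
    fun A => inv_anti₀ ?_ ?_) ((hP s).1 i)).trans h
  · exact add_pos_of_pos_of_nonneg one_pos (Finset.sum_nonneg fun _ _ => by split_ifs <;> norm_num)
  · unfold buckets
    gcongr with j
    exact Finset.single_le_sum (f := fun s => if A j s = i then (1 : ℝ) else 0)
      (fun _ _ => by split_ifs <;> norm_num) (Finset.mem_univ s)

/-- Splitting every element evenly into its buckets makes all the distributions flat on average. -/
theorem expect_sum_inv_buckets_mul_sq_le (hP : ∀ s, P s ∈ stdSimplex ℝ α) (k : ℕ) :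
    expect (iidWeight (prodWeight P) k) (fun A => ∑ i, (buckets A i)⁻¹ * ∑ s, P s i ^ 2)
      ≤ Fintype.card ι / (k + 1) := by
  calc _ = ∑ s, ∑ i, P s i *
          (P s i * expect (iidWeight (prodWeight P) k) fun A => (buckets A i)⁻¹) := by
        simp only [expect_sum, expect_mul_const, Finset.mul_sum]
        rw [Finset.sum_comm]
        exact Finset.sum_congr rfl fun s _ => Finset.sum_congr rfl fun i _ => by ring
    _ ≤ ∑ s, ∑ i, P s i * (1 / (k + 1)) :=
        Finset.sum_le_sum fun s _ => Finset.sum_le_sum fun i _ =>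
          mul_le_mul_of_nonneg_left (mul_expect_inv_buckets_le hP k s i) ((hP s).1 i)
    _ = _ := by
        simp only [← Finset.sum_mul, (hP _).2, Finset.sum_const, Finset.card_univ, nsmul_eq_mul,
          one_mul]
        exact mul_one_div _ _

end Flattening

section Tester

/-- Three sequences of samples, regarded as one sequence of sample triples. -/
def tripleEquiv (α : Type*) (m : ℕ) :
    (Fin m → α) × (Fin m → α) × (Fin m → α) ≃ (Fin m → Fin 3 → α) where
  toFun x j := ![x.1 j, x.2.1 j, x.2.2 j]
  invFun ω := (fun j => ω j 0, fun j => ω j 1, fun j => ω j 2)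
  left_inv _ := rfl
  right_inv ω := by
    ext j s
    fin_cases s <;> rfl

variable {n k m : ℕ}

/-- The three unknown distributions as one family, the distribution of a sample triple being their
product. -/
def sources (p q₁ q₂ : Dist n) : Fin 3 → Fin n → ℝ := ![p.1, q₁.1, q₂.1]

/-- The algorithm that applies `G` to the sequence of sample triples. -/
def tripleAlgorithm (G : (Fin m → Fin 3 → Fin n) → unitInterval) : Algorithm n m m m :=
  fun x y z => G (tripleEquiv (Fin n) m (x, y, z))

theorem acceptProb_tripleAlgorithm (G : (Fin m → Fin 3 → Fin n) → unitInterval)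
    (p q₁ q₂ : Dist n) : acceptProb (tripleAlgorithm G) p q₁ q₂
      = expect (iidWeight (prodWeight (sources p q₁ q₂)) m) fun ω => (G ω : ℝ) := by
  rw [expect, ← (tripleEquiv (Fin n) m).sum_comp]
  simp only [Fintype.sum_prod_type, acceptProb, tripleAlgorithm]
  refine Finset.sum_congr rfl fun x _ => Finset.sum_congr rfl fun y _ =>
    Finset.sum_congr rfl fun z _ => congrArg (· * (G _ : ℝ)) ?_
  simp only [sampleProb, ← Finset.prod_mul_distrib, iidWeight]
  refine Finset.prod_congr rfl fun j _ => ?_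
  exact (Fin.prod_univ_three fun s => sources p q₁ q₂ s (![x j, y j, z j] s)).symm

open Classical in
/-- The tester: the first `k` sample triples determine the buckets, the remaining `2 m` triples
are used for the statistic. -/
noncomputable def mixtureTester (n k m : ℕ) (h : ℝ) :
    Algorithm n (k + (m + m)) (k + (m + m)) (k + (m + m)) :=
  tripleAlgorithm fun ω =>
    if Accepts (fun i => (buckets (fun j : Fin k => ω (Fin.castAdd (m + m) j)) i)⁻¹) h
      (fun j : Fin m => ω (Fin.natAdd k (Fin.castAdd m j)))
      (fun j : Fin m => ω (Fin.natAdd k (Fin.natAdd m j))) then 1 else 0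

theorem acceptProb_mixtureTester (n k m : ℕ) (h : ℝ) (p q₁ q₂ : Dist n) :
    acceptProb (mixtureTester n k m h) p q₁ q₂
      = expect (iidWeight (prodWeight (sources p q₁ q₂)) k) fun A =>
        prob (pairWeight (iidWeight (prodWeight (sources p q₁ q₂)) m)
            (iidWeight (prodWeight (sources p q₁ q₂)) m))
          fun x => Accepts (fun i => (buckets A i)⁻¹) h x.1 x.2 := by
  rw [mixtureTester, acceptProb_tripleAlgorithm]
  simp only [expect_iidWeight_add, prob, expect_pairWeight]
  refine congrArg _ (funext fun A => congrArg _ (funext fun B => congrArg _ (funext fun C => ?_)))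
  have hA : (fun j => Fin.append A (Fin.append B C) (Fin.castAdd (m + m) j)) = A := by
    simp only [Fin.append_left]
  have hB : (fun j => Fin.append A (Fin.append B C) (Fin.natAdd k (Fin.castAdd m j))) = B := by
    simp only [Fin.append_left, Fin.append_right]
  have hC : (fun j => Fin.append A (Fin.append B C) (Fin.natAdd k (Fin.natAdd m j))) = C := by
    simp only [Fin.append_right]
  rw [hA, hB, hC]
  split_ifs <;> rfl

variable {p q₁ q₂ : Dist n}

theorem sources_mem_stdSimplex (p q₁ q₂ : Dist n) (s : Fin 3) :
    sources p q₁ q₂ s ∈ stdSimplex ℝ (Fin n) := by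
  fin_cases s
  exacts [p.2, q₁.2, q₂.2]

theorem comb_sources_mixVec (p q₁ q₂ : Dist n) (x : ℝ) (i : Fin n) :
    comb (sources p q₁ q₂) (mixVec x) i = p.1 i - ((1 - x) * q₁.1 i + x * q₂.1 i) := by
  simp only [comb, mixVec, sources, Fin.sum_univ_three, Matrix.cons_val]
  ring

theorem le_weightedInner_of_isFar {ε : ℝ} (hε : 0 ≤ ε) (hfar : IsFar ε p (mixtures q₁ q₂))
    {b : Fin n → ℝ} (hb : ∀ i, 0 < b i) (hsum : 0 < ∑ i, b i) {x : ℝ}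
    (hx : x ∈ Set.Icc (0 : ℝ) 1) :
    ε ^ 2 / ∑ i, b i ≤ weightedInner (fun i => (b i)⁻¹) (comb (sources p q₁ q₂) (mixVec x))
      (comb (sources p q₁ q₂) (mixVec x)) := by
  let r : Dist n := ⟨(1 - x) • q₁.1 + x • q₂.1,
    convex_stdSimplex ℝ (Fin n) q₁.2 q₂.2 (sub_nonneg.2 hx.2) hx.1 (sub_add_cancel 1 x)⟩
  have hdist : ε ≤ ∑ i, |comb (sources p q₁ q₂) (mixVec x) i| := by
    simp only [comb_sources_mixVec]
    exact hfar r ⟨x, hx.1, hx.2, fun _ => rfl⟩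
  rw [div_le_iff₀' hsum]
  exact (pow_le_pow_left₀ hε hdist 2).trans (sq_sum_abs_le_sum_mul_weightedInner_inv hb _)

/-- By Markov's inequality, the buckets fail to flatten the distributions with probability at most
`1 / 10`. -/
theorem expect_iidWeight_le_of_flat {P : Fin 3 → Fin n → ℝ} (hP : ∀ s, P s ∈ stdSimplex ℝ (Fin n))
    {f : (Fin k → Fin 3 → Fin n) → ℝ} (hf : ∀ A, f A ≤ 1)
    (hflat : ∀ A, ∑ i, (buckets A i)⁻¹ * ∑ s, P s i ^ 2 ≤ √(30 / (k + 1)) ^ 2 → f A ≤ 1 / 5) :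
    expect (iidWeight (prodWeight P) k) f ≤ 1 / 3 := by
  have hk : (0 : ℝ) < 30 / (k + 1) := by positivity
  rw [Real.sq_sqrt hk.le] at hflat
  refine (expect_le_add_div (iidWeight_mem_stdSimplex (prodWeight_mem_stdSimplex hP) k)
    (by norm_num) hk hf (fun A => Finset.sum_nonneg fun i _ =>
      mul_nonneg (inv_buckets_mem_unitInterval A i).1 (Finset.sum_nonneg fun _ _ => sq_nonneg _))
    hflat (expect_sum_inv_buckets_mul_sq_le hP k)).trans ?_
  rw [Fintype.card_fin]
  field_simp
  norm_num

variable {ε h : ℝ}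

theorem le_acceptProb_mixtureTester_of_mem_mixtures (hm : m ≠ 0) (hh : 0 < h)
    (hκ : √(30 / (k + 1)) / m ≤ h / 40000) (hp : p ∈ mixtures q₁ q₂) :
    2 / 3 ≤ acceptProb (mixtureTester n k m h) p q₁ q₂ := by
  obtain ⟨x, hx0, hx1, hx⟩ := hp
  have hP := sources_mem_stdSimplex p q₁ q₂
  have hiid (l : ℕ) := iidWeight_mem_stdSimplex (prodWeight_mem_stdSimplex hP) l
  have hpair := pairWeight_mem_stdSimplex (hiid m) (hiid m)
  have hmix : comb (sources p q₁ q₂) (mixVec x) = 0 :=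
    funext fun i => (comb_sources_mixVec p q₁ q₂ x i).trans (sub_eq_zero.2 (hx i))
  have hreject := expect_iidWeight_le_of_flat hP (k := k) (fun A => prob_le_one hpair _)
    fun A hA => prob_not_accepts_le hP (inv_buckets_mem_unitInterval A) (Real.sqrt_nonneg _) hA hm
      hh hκ ⟨hx0, hx1⟩ hmix
  simp only [prob_not hpair.2, expect_sub, expect_const (hiid k).2] at hreject
  rw [acceptProb_mixtureTester]
  linarith

theorem acceptProb_mixtureTester_le_of_isFar (hn : n ≠ 0) (hm : m ≠ 0) (hε : 0 ≤ ε)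
    (hκ : √(30 / (k + 1)) / m ≤ ε ^ 2 / (n + 3 * k) / 40000)
    (hp : IsFar ε p (mixtures q₁ q₂)) :
    acceptProb (mixtureTester n k m (ε ^ 2 / (n + 3 * k))) p q₁ q₂ ≤ 1 / 3 := by
  have hP := sources_mem_stdSimplex p q₁ q₂
  have hiid := iidWeight_mem_stdSimplex (prodWeight_mem_stdSimplex hP) m
  rw [acceptProb_mixtureTester]
  refine expect_iidWeight_le_of_flat hP
    (fun A => prob_le_one (pairWeight_mem_stdSimplex hiid hiid) _) fun A hA =>
      prob_accepts_le hP (inv_buckets_mem_unitInterval A) (by positivity) hA hm hκ fun x hx => ?_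
  have hsum : ∑ i, buckets A i = n + 3 * k := by simpa using sum_buckets A
  rw [← hsum]
  refine le_weightedInner_of_isFar hε hp (fun i => zero_lt_one.trans_le (one_le_buckets A i)) ?_ hx
  rw [hsum]
  positivity

theorem isMixtureTester_mixtureTester (hn : n ≠ 0) (hm : m ≠ 0) (hε : 0 < ε)
    (hκ : √(30 / (k + 1)) / m ≤ ε ^ 2 / (n + 3 * k) / 40000) :
    IsMixtureTester ε (mixtureTester n k m (ε ^ 2 / (n + 3 * k))) := fun p q₁ q₂ =>
  ⟨le_acceptProb_mixtureTester_of_mem_mixtures hm (by positivity) hκ, fun hfar => by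
    linarith [acceptProb_mixtureTester_le_of_isFar hn hm hε.le hκ hfar]⟩

end Tester

section SampleSize

variable {n : ℕ} {ε : ℝ}

theorem two_thirds_term_pow_three (n : ℕ) (hε : 0 < ε) :
    ((n : ℝ) ^ (2 / 3 : ℝ) / ε ^ (4 / 3 : ℝ)) ^ 3 = n ^ 2 / ε ^ 4 := by
  rw [div_pow, ← Real.rpow_natCast, ← Real.rpow_natCast, ← Real.rpow_mul (Nat.cast_nonneg n),
    ← Real.rpow_mul hε.le]
  norm_num

theorem l1Dist_le_two (p q : Dist n) : l1Dist p q ≤ 2 :=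
  calc l1Dist p q ≤ ∑ i, (p.1 i + q.1 i) := Finset.sum_le_sum fun i _ => by
        rw [abs_le]
        constructor <;> linarith [p.2.1 i, q.2.1 i]
    _ = 2 := by rw [Finset.sum_add_distrib, p.2.2, q.2.2, one_add_one_eq_two]

theorem isMixtureTester_const_one (hε : 2 < ε) :
    IsMixtureTester ε (fun _ _ _ => 1 : Algorithm n 0 0 0) := fun p q₁ q₂ =>
  ⟨fun _ => by simpa [acceptProb, sampleProb] using by norm_num, fun hfar =>
    absurd ((hfar q₁ ⟨0, le_rfl, zero_le_one, fun i => by ring⟩).trans (l1Dist_le_two p q₁))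
      hε.not_ge⟩

/-- The minimum is the number of preliminary sample triples used by the tester, which balances the
two terms of the rate. -/
theorem div_sq_mul_sqrt_min_le_rate (hn : n ≠ 0) (hε : 0 < ε) :
    n / (ε ^ 2 * √((min n ⌊(n : ℝ) ^ (2 / 3 : ℝ) / ε ^ (4 / 3 : ℝ)⌋₊ : ℕ) + 1)) ≤ rate n ε := by
  set R : ℝ := (n : ℝ) ^ (2 / 3 : ℝ) / ε ^ (4 / 3 : ℝ)
  have hR0 : 0 ≤ R := by positivity
  have hS0 : 0 ≤ √(n : ℝ) / ε ^ 2 := by positivity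
  have hrate : rate n ε = √(n : ℝ) / ε ^ 2 + R := rfl
  rcases le_total n ⌊R⌋₊ with h | h
  · rw [min_eq_left h]
    calc n / (ε ^ 2 * √(n + 1 : ℝ)) ≤ n / (ε ^ 2 * √(n : ℝ)) := by gcongr; linarith
      _ = √(n : ℝ) / ε ^ 2 := by rw [mul_comm, ← div_div, Real.div_sqrt]
      _ ≤ rate n ε := by linarith
  · have hsqrt : n / ε ^ 2 = R * √R := by
      refine (pow_left_inj₀ (by positivity) (by positivity) two_ne_zero).1 ?_
      rw [mul_pow, Real.sq_sqrt hR0, ← pow_succ, two_thirds_term_pow_three n hε, div_pow, ← pow_mul]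
    rw [min_eq_right h, ← div_div, hsqrt, div_le_iff₀ (by positivity)]
    refine mul_le_mul (by linarith) (Real.sqrt_le_sqrt (Nat.lt_floor_add_one R).le)
      (Real.sqrt_nonneg R) (by linarith)

theorem one_le_four_mul_rate (hn : n ≠ 0) (hε0 : 0 < ε) (hε2 : ε ≤ 2) : 1 ≤ 4 * rate n ε := by
  have hsqrt : 1 ≤ √(n : ℝ) := Real.one_le_sqrt.2 (Nat.one_le_cast.2 (Nat.one_le_iff_ne_zero.2 hn))
  have hfirst : 1 / 4 ≤ √(n : ℝ) / ε ^ 2 := by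
    rw [div_le_div_iff₀ (by norm_num) (by positivity)]
    nlinarith
  have hrate : √(n : ℝ) / ε ^ 2 ≤ rate n ε := le_add_of_nonneg_right (by positivity)
  linarith

theorem sqrt_div_le_of_le {k m : ℕ} (hn : n ≠ 0) (hε : 0 < ε) (hk : k ≤ n)
    (hm : 960000 * (n / (ε ^ 2 * √(k + 1))) ≤ m) :
    √(30 / (k + 1)) / m ≤ ε ^ 2 / (n + 3 * k) / 40000 := by
  have hsqrt : √(30 / (k + 1)) ≤ 6 / √(k + 1 : ℝ) := by
    rw [Real.sqrt_div (by norm_num)]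
    gcongr
    rw [Real.sqrt_le_left (by norm_num)]
    norm_num
  have hkn : (k : ℝ) ≤ n := Nat.cast_le.2 hk
  calc √(30 / (k + 1)) / m ≤ 6 / √(k + 1 : ℝ) / (960000 * (n / (ε ^ 2 * √(k + 1)))) := by gcongr
    _ = ε ^ 2 / (4 * n) / 40000 := by field_simp; norm_num
    _ ≤ ε ^ 2 / (n + 3 * k) / 40000 := by gcongr; linarith

theorem exists_mixtureTester : ∃ C : ℝ, 0 < C ∧ ∀ (n : ℕ) (ε : ℝ), 1 ≤ n → 0 < ε →
    ∃ (m₀ m₁ m₂ : ℕ) (T : Algorithm n m₀ m₁ m₂), IsMixtureTester ε T ∧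
      ((m₀ + m₁ + m₂ : ℕ) : ℝ) ≤ C * rate n ε := by
  refine ⟨6000000, by norm_num, fun n ε hn hε => ?_⟩
  have hn0 : n ≠ 0 := Nat.one_le_iff_ne_zero.1 hn
  rcases lt_or_ge 2 ε with hε2 | hε2
  · refine ⟨0, 0, 0, _, isMixtureTester_const_one hε2, ?_⟩
    rw [Nat.cast_zero, rate]
    positivity
  set R : ℝ := (n : ℝ) ^ (2 / 3 : ℝ) / ε ^ (4 / 3 : ℝ)
  set k := min n ⌊R⌋₊
  set X : ℝ := n / (ε ^ 2 * √(k + 1 : ℝ))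
  set m := ⌈960000 * X⌉₊
  have hX0 : 0 < 960000 * X := by positivity
  have hXrate : X ≤ rate n ε := div_sq_mul_sqrt_min_le_rate hn0 hε
  have hkrate : (k : ℝ) ≤ rate n ε :=
    calc (k : ℝ) ≤ ⌊R⌋₊ := Nat.cast_le.2 (min_le_right _ _)
      _ ≤ R := Nat.floor_le (by positivity)
      _ ≤ rate n ε := le_add_of_nonneg_left (by positivity)
  refine ⟨k + (m + m), k + (m + m), k + (m + m), mixtureTester n k m (ε ^ 2 / (n + 3 * k)),
    isMixtureTester_mixtureTester hn0 (Nat.ceil_pos.2 hX0).ne' hε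
      (sqrt_div_le_of_le hn0 hε (min_le_left _ _) (Nat.le_ceil _)), ?_⟩
  have hone := one_le_four_mul_rate hn0 hε hε2
  have hm : (m : ℝ) < 960000 * X + 1 := Nat.ceil_lt_add_one hX0.le
  push_cast
  linarith

end SampleSize

section SecondMoment

variable {Ω ι : Type*} [Fintype Ω] [Fintype ι] {μ ν f : Ω → ℝ}

theorem sq_expect_sub_expect_le (hμ : ∀ a, 0 ≤ μ a) (hν : ∀ a, μ a = 0 → ν a = 0)
    (hf : ∀ a, |f a| ≤ 1) :
    (expect ν f - expect μ f) ^ 2 ≤ (∑ a, μ a) * weightedInner μ⁻¹ (ν - μ) (ν - μ) := by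
  have hdiff : expect ν f - expect μ f = ∑ a, (ν a - μ a) * f a := by
    simp only [expect, sub_mul, Finset.sum_sub_distrib]
  rw [hdiff]
  refine Finset.sum_sq_le_sum_mul_sum_of_sq_le_mul _ (fun a _ => hμ a)
    (fun a _ => mul_nonneg (inv_nonneg.2 (hμ a)) (mul_self_nonneg _)) fun a _ => ?_
  rcases (hμ a).eq_or_lt with h | h
  · simp [← h, hν a h.symm]
  · rw [Pi.inv_apply, mul_inv_cancel_left₀ h.ne', Pi.sub_apply, ← sq, mul_pow]
    exact mul_le_of_le_one_right (sq_nonneg _) ((sq_le_one_iff_abs_le_one _).2 (hf a))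

theorem weightedInner_inv_sub_sub (hν : ∀ a, μ a = 0 → ν a = 0) :
    weightedInner μ⁻¹ (ν - μ) (ν - μ) = weightedInner μ⁻¹ ν ν - 2 * ∑ a, ν a + ∑ a, μ a := by
  simp only [weightedInner, Finset.mul_sum, ← Finset.sum_sub_distrib, ← Finset.sum_add_distrib]
  refine Finset.sum_congr rfl fun a _ => ?_
  rcases eq_or_ne (μ a) 0 with h | h
  · simp [h, hν a h]
  · simp only [Pi.inv_apply, Pi.sub_apply]
    field_simp
    ring

theorem weightedInner_expect_expect (a : Ω → ℝ) (ν : ι → ℝ) (P : ι → Ω → ℝ) :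
    weightedInner a (fun x => expect ν fun z => P z x) (fun x => expect ν fun z => P z x)
      = expect ν fun z => expect ν fun z' => weightedInner a (P z) (P z') := by
  simp only [weightedInner, expect_sum, expect_const_mul, expect_mul_const]

theorem weightedInner_inv_iidWeight (u v w : Ω → ℝ) (m : ℕ) :
    weightedInner (iidWeight u m)⁻¹ (iidWeight v m) (iidWeight w m)
      = weightedInner u⁻¹ v w ^ m := by
  classical
  simp only [weightedInner, iidWeight, prodWeight, Pi.inv_apply, ← Finset.prod_mul_distrib,
    ← Finset.prod_inv_distrib, Fintype.sum_pow]

/-- Ingster's method: the right-hand side is the `χ²`-divergence of the mixture from the product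
measure, which is explicit because second moments of likelihood ratios multiply. -/
theorem sq_expect_iidWeight_mixture_sub_le {ν : ι → ℝ} (hν : ∑ z, ν z = 1)
    {P : ι → Ω → ℝ} (hP : ∀ z, ∑ a, P z a = 1) (hμ : μ ∈ stdSimplex ℝ Ω)
    (hPμ : ∀ z a, μ a = 0 → P z a = 0) {m : ℕ} {f : (Fin m → Ω) → ℝ} (hf : ∀ x, |f x| ≤ 1) :
    (expect ν (fun z => expect (iidWeight (P z) m) f) - expect (iidWeight μ m) f) ^ 2
      ≤ expect ν (fun z => expect ν fun z' => weightedInner μ⁻¹ (P z) (P z') ^ m) - 1 := by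
  classical
  set mixture : (Fin m → Ω) → ℝ := fun x => expect ν fun z => iidWeight (P z) m x with hmixture
  have hμm := iidWeight_mem_stdSimplex hμ m
  have hac : ∀ x, iidWeight μ m x = 0 → mixture x = 0 := fun x hx => by
    have hprod : ∏ j, μ (x j) = 0 := hx
    obtain ⟨j, hj, hxj⟩ := Finset.prod_eq_zero_iff.1 hprod
    exact Finset.sum_eq_zero fun z _ =>
      mul_eq_zero_of_right _ (Finset.prod_eq_zero hj (hPμ z _ hxj))
  have hsum : ∑ x, mixture x = 1 := by
    rw [hmixture, ← expect_sum]
    simp only [iidWeight, sum_prodWeight fun _ => hP _]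
    exact expect_const hν 1
  have hexpect : expect mixture f = expect ν fun z => expect (iidWeight (P z) m) f := by
    simp only [hmixture, expect, Finset.sum_mul, Finset.mul_sum, mul_assoc]
    exact Finset.sum_comm
  have hcs := sq_expect_sub_expect_le hμm.1 hac hf
  rw [weightedInner_inv_sub_sub hac, hμm.2, hsum, hexpect, hmixture,
    weightedInner_expect_expect] at hcs
  simp only [weightedInner_inv_iidWeight] at hcs
  linarith

end SecondMoment

section PerturbedUniform

variable {h m : ℕ} {ε : ℝ}

/-- The sign `±1` encoded by a Boolean. -/
def sgn (b : Bool) : ℝ := if b then 1 else -1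

/-- The weights of a fair coin. -/
noncomputable def fairCoin : Bool → ℝ := fun _ => 1 / 2

theorem fairCoin_mem_stdSimplex : fairCoin ∈ stdSimplex ℝ Bool :=
  ⟨fun _ => by norm_num [fairCoin], by norm_num [fairCoin]⟩

theorem abs_sgn (b : Bool) : |sgn b| = 1 := by cases b <;> simp [sgn]

theorem expect_fairCoin_exp_mul_sgn (t : ℝ) (a : Bool) :
    expect fairCoin (fun b => Real.exp (t * (sgn a * sgn b))) = Real.cosh t := by
  rw [Real.cosh_eq]
  cases a <;> simp [expect, fairCoin, sgn] <;> ring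

/-- Paninski's perturbation of the uniform distribution on `2 h` elements: the elements are grouped
into `h` pairs, and `z j` tells which element of the `j`-th pair gains mass. -/
noncomputable def perturbed (ε : ℝ) (z : Fin h → Bool) (c : Fin h × Bool) : ℝ :=
  (1 + ε * (sgn (z c.1) * sgn c.2)) / (2 * h)

/-- The uniform distribution on the `h` pairs. -/
noncomputable def uniformPairs (h : ℕ) (_ : Fin h × Bool) : ℝ := 1 / (2 * h)

theorem uniformPairs_mem_stdSimplex (hh : h ≠ 0) :
    uniformPairs h ∈ stdSimplex ℝ (Fin h × Bool) := by
  refine ⟨fun c => by unfold uniformPairs; positivity, ?_⟩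
  simp only [uniformPairs, Finset.sum_const, Finset.card_univ, Fintype.card_prod, Fintype.card_fin,
    Fintype.card_bool, nsmul_eq_mul, Nat.cast_mul, Nat.cast_ofNat]
  field_simp

theorem abs_perturbed_sub_uniformPairs (hε : 0 ≤ ε) (z : Fin h → Bool) (c : Fin h × Bool) :
    |perturbed ε z c - uniformPairs h c| = ε / (2 * h) := by
  have hdiff : perturbed ε z c - uniformPairs h c = ε * (sgn (z c.1) * sgn c.2) / (2 * h) := by
    rw [perturbed, uniformPairs]
    ring
  rw [hdiff, abs_div, abs_mul, abs_mul, abs_sgn, abs_sgn, abs_of_nonneg hε,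
    abs_of_nonneg (by positivity : (0 : ℝ) ≤ 2 * h), mul_one, mul_one]

theorem perturbed_mem_stdSimplex (hh : h ≠ 0) (hε0 : 0 ≤ ε) (hε1 : ε ≤ 1) (z : Fin h → Bool) :
    perturbed ε z ∈ stdSimplex ℝ (Fin h × Bool) := by
  refine ⟨fun c => ?_, ?_⟩
  · have hle : |ε * (sgn (z c.1) * sgn c.2)| ≤ 1 := by
      rwa [abs_mul, abs_mul, abs_sgn, abs_sgn, abs_of_nonneg hε0, mul_one, mul_one]
    exact div_nonneg (by linarith [neg_le_of_abs_le hle]) (by positivity)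
  · have hpair : ∀ j, ∑ b, perturbed ε z (j, b) = 1 / h := fun j => by
      simp only [perturbed, sgn, Fintype.sum_bool, if_true, Bool.false_eq_true, if_false]
      field_simp
      ring
    simp only [Fintype.sum_prod_type, hpair, Finset.sum_const, Finset.card_univ, Fintype.card_fin,
      nsmul_eq_mul]
    field_simp

theorem weightedInner_perturbed (hh : h ≠ 0) (ε : ℝ) (z z' : Fin h → Bool) :
    weightedInner (uniformPairs h)⁻¹ (perturbed ε z) (perturbed ε z')
      = 1 + ε ^ 2 / h * ∑ j, sgn (z j) * sgn (z' j) := by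
  have hpair : ∀ j, ∑ b, (uniformPairs h (j, b))⁻¹ * (perturbed ε z (j, b) * perturbed ε z' (j, b))
      = 1 / h + ε ^ 2 / h * (sgn (z j) * sgn (z' j)) := fun j => by
    have htrue : sgn true = 1 := rfl
    have hfalse : sgn false = -1 := rfl
    simp only [perturbed, uniformPairs, Fintype.sum_bool, htrue, hfalse]
    field_simp
    ring
  simp only [weightedInner, Pi.inv_apply, Fintype.sum_prod_type, hpair, Finset.sum_add_distrib,
    ← Finset.mul_sum, Finset.sum_const, Finset.card_univ, Fintype.card_fin, nsmul_eq_mul]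
  field_simp

theorem weightedInner_perturbed_pow_le (hh : h ≠ 0) (hε0 : 0 ≤ ε) (hε1 : ε ≤ 1)
    (z z' : Fin h → Bool) :
    weightedInner (uniformPairs h)⁻¹ (perturbed ε z) (perturbed ε z') ^ m
      ≤ ∏ j, Real.exp (m * ε ^ 2 / h * (sgn (z j) * sgn (z' j))) := by
  have hnonneg : 0 ≤ weightedInner (uniformPairs h)⁻¹ (perturbed ε z) (perturbed ε z') :=
    Finset.sum_nonneg fun c _ => mul_nonneg
      (inv_nonneg.2 ((uniformPairs_mem_stdSimplex hh).1 c)) (mul_nonneg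
        ((perturbed_mem_stdSimplex hh hε0 hε1 z).1 c)
        ((perturbed_mem_stdSimplex hh hε0 hε1 z').1 c))
  rw [weightedInner_perturbed hh] at hnonneg ⊢
  calc _ ≤ Real.exp (ε ^ 2 / h * ∑ j, sgn (z j) * sgn (z' j)) ^ m := by
        refine pow_le_pow_left₀ hnonneg ?_ m
        rw [add_comm]
        exact Real.add_one_le_exp _
    _ = _ := by
        rw [← Real.exp_nat_mul, ← Real.exp_sum, ← Finset.mul_sum]
        congr 1
        ring

theorem perturbed_second_moment_le (hh : h ≠ 0) (hε0 : 0 ≤ ε) (hε1 : ε ≤ 1) :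
    expect (prodWeight fun _ => fairCoin) (fun z => expect (prodWeight fun _ => fairCoin) fun z' =>
        weightedInner (uniformPairs h)⁻¹ (perturbed ε z) (perturbed ε z') ^ m)
      ≤ Real.exp (m ^ 2 * ε ^ 4 / (2 * h)) := by
  have hcoins := prodWeight_mem_stdSimplex fun _ : Fin h => fairCoin_mem_stdSimplex
  calc _ ≤ expect (prodWeight fun _ => fairCoin) fun z =>
        expect (prodWeight fun _ => fairCoin) fun z' =>
          ∏ j, Real.exp (m * ε ^ 2 / h * (sgn (z j) * sgn (z' j))) :=
        expect_mono hcoins.1 fun z => expect_mono hcoins.1 fun z' =>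
          weightedInner_perturbed_pow_le hh hε0 hε1 z z'
    _ = Real.cosh (m * ε ^ 2 / h) ^ h := by
        have hinner : ∀ z : Fin h → Bool, expect (prodWeight fun _ => fairCoin) (fun z' =>
            ∏ j, Real.exp (m * ε ^ 2 / h * (sgn (z j) * sgn (z' j))))
            = Real.cosh (m * ε ^ 2 / h) ^ h := fun z => by
          rw [expect_prodWeight_prod _ fun j b => Real.exp (m * ε ^ 2 / h * (sgn (z j) * sgn b))]
          simp only [expect_fairCoin_exp_mul_sgn, Finset.prod_const, Finset.card_univ,
            Fintype.card_fin]
        simp only [hinner, expect_const hcoins.2]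
    _ ≤ Real.exp ((m * ε ^ 2 / h) ^ 2 / 2) ^ h :=
        pow_le_pow_left₀ (Real.cosh_pos _).le (Real.cosh_le_exp_half_sq _) h
    _ = _ := by
        rw [← Real.exp_nat_mul]
        congr 1
        field_simp

end PerturbedUniform

section Extension

variable {n : ℕ} {β : Type*} [Fintype β] (e : β ↪ Fin n) {v w : β → ℝ}

theorem sum_eq_sum_comp_embedding {α : Type*} [Fintype α] (e : β ↪ α) {f : α → ℝ}
    (hf : ∀ i ∉ Set.range e, f i = 0) :
    ∑ i, f i = ∑ c, f (e c) :=
  (Fintype.sum_of_injective e e.injective _ f hf fun _ => rfl).symm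

/-- The distribution on `n` elements obtained from one on a finite type embedded into them. -/
noncomputable def extendDist (hv : v ∈ stdSimplex ℝ β) : Dist n := by
  refine ⟨Function.extend e v 0, fun i => ?_, ?_⟩
  · by_cases hi : i ∈ Set.range e
    · obtain ⟨c, rfl⟩ := hi
      rw [e.injective.extend_apply]
      exact hv.1 c
    · rw [Function.extend_apply' _ _ _ hi]
      exact le_rfl
  · rw [sum_eq_sum_comp_embedding e fun i hi => Function.extend_apply' v _ i hi]
    simp only [e.injective.extend_apply, hv.2]

theorem extendDist_apply (hv : v ∈ stdSimplex ℝ β) (c : β) : (extendDist e hv).1 (e c) = v c :=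
  e.injective.extend_apply _ _ c

theorem extendDist_eq_zero (hv : v ∈ stdSimplex ℝ β) {i : Fin n} (hi : i ∉ Set.range e) :
    (extendDist e hv).1 i = 0 :=
  Function.extend_apply' _ _ _ hi

theorem l1Dist_extendDist (hv : v ∈ stdSimplex ℝ β) (hw : w ∈ stdSimplex ℝ β) :
    l1Dist (extendDist e hv) (extendDist e hw) = ∑ c, |v c - w c| := by
  rw [l1Dist, sum_eq_sum_comp_embedding e fun i hi => by
    rw [extendDist_eq_zero e hv hi, extendDist_eq_zero e hw hi, sub_zero, abs_zero]]
  simp only [extendDist_apply]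

theorem weightedInner_inv_extendDist {u : β → ℝ} (hu : u ∈ stdSimplex ℝ β)
    (hv : v ∈ stdSimplex ℝ β) (hw : w ∈ stdSimplex ℝ β) :
    weightedInner (extendDist e hu).1⁻¹ (extendDist e hv).1 (extendDist e hw).1
      = weightedInner u⁻¹ v w := by
  rw [weightedInner, sum_eq_sum_comp_embedding e fun i hi => by
    rw [extendDist_eq_zero e hv hi, zero_mul, mul_zero]]
  simp only [Pi.inv_apply, extendDist_apply, weightedInner]

end Extension

section UniformityLowerBound

variable {n m₀ m₁ m₂ : ℕ} {ε : ℝ}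

theorem self_mem_mixtures (q : Dist n) : q ∈ mixtures q q :=
  ⟨0, le_rfl, zero_le_one, fun i => by ring⟩

theorem eq_of_mem_mixtures_self {q r : Dist n} (hr : r ∈ mixtures q q) : r = q := by
  obtain ⟨α, -, -, hα⟩ := hr
  ext i
  calc r.1 i = (1 - α) * q.1 i + α * q.1 i := hα i
    _ = q.1 i := by ring

/-- The probability of accepting, given the samples `x` from the first distribution. -/
noncomputable def acceptGiven (T : Algorithm n m₀ m₁ m₂) (q₁ q₂ : Dist n) (x : Fin m₀ → Fin n) :
    ℝ :=
  expect (iidWeight q₁.1 m₁) fun y => expect (iidWeight q₂.1 m₂) fun z => T x y z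

theorem acceptProb_eq_expect_acceptGiven (T : Algorithm n m₀ m₁ m₂) (p q₁ q₂ : Dist n) :
    acceptProb T p q₁ q₂ = expect (iidWeight p.1 m₀) (acceptGiven T q₁ q₂) := by
  simp only [acceptProb, acceptGiven, sampleProb, expect, iidWeight, prodWeight, Finset.mul_sum,
    mul_assoc]

theorem acceptGiven_mem_unitInterval (T : Algorithm n m₀ m₁ m₂) (q₁ q₂ : Dist n)
    (x : Fin m₀ → Fin n) : acceptGiven T q₁ q₂ x ∈ Set.Icc (0 : ℝ) 1 := by
  have h₁ := iidWeight_mem_stdSimplex q₁.2 m₁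
  have h₂ := iidWeight_mem_stdSimplex q₂.2 m₂
  refine ⟨expect_nonneg h₁.1 fun y => expect_nonneg h₂.1 fun z => (T x y z).2.1, ?_⟩
  calc acceptGiven T q₁ q₂ x
      ≤ expect (iidWeight q₁.1 m₁) fun _ => expect (iidWeight q₂.1 m₂) fun _ => 1 :=
        expect_mono h₁.1 fun y => expect_mono h₂.1 fun z => (T x y z).2.2
    _ = 1 := by simp only [expect_const h₂.2, expect_const h₁.2]

theorem one_div_twenty_le_of_le_exp_sub_one {y : ℝ} (hy : 1 / 9 ≤ Real.exp y - 1) :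
    1 / 20 ≤ y := by
  by_contra! hlt
  have hneg : 1 - y ≤ Real.exp (-y) := by linarith [Real.add_one_le_exp (-y)]
  have hinv : Real.exp (-y) * Real.exp y = 1 := by
    rw [← Real.exp_add, neg_add_cancel, Real.exp_zero]
  nlinarith [Real.exp_pos y]

theorem isFar_extendDist_perturbed {h : ℕ} (e : Fin h × Bool ↪ Fin n) (hh : h ≠ 0) (hε0 : 0 ≤ ε)
    (hε1 : ε ≤ 1) (z : Fin h → Bool) :
    IsFar ε (extendDist e (perturbed_mem_stdSimplex hh hε0 hε1 z))
      (mixtures (extendDist e (uniformPairs_mem_stdSimplex hh))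
        (extendDist e (uniformPairs_mem_stdSimplex hh))) := by
  intro r hr
  rw [eq_of_mem_mixtures_self hr, l1Dist_extendDist]
  simp only [abs_perturbed_sub_uniformPairs hε0, Finset.sum_const, Finset.card_univ,
    Fintype.card_prod, Fintype.card_fin, Fintype.card_bool, nsmul_eq_mul, Nat.cast_mul,
    Nat.cast_ofNat]
  field_simp
  exact le_rfl

theorem one_div_nine_le_second_moment_sub_one {T : Algorithm n m₀ m₁ m₂}
    (hT : IsMixtureTester ε T) {h : ℕ} (e : Fin h × Bool ↪ Fin n) (hh : h ≠ 0) (hε0 : 0 ≤ ε)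
    (hε1 : ε ≤ 1) : 1 / 9 ≤ Real.exp (m₀ ^ 2 * ε ^ 4 / (2 * h)) - 1 := by
  set coins := prodWeight fun _ : Fin h => fairCoin
  have hcoins : coins ∈ stdSimplex ℝ (Fin h → Bool) :=
    prodWeight_mem_stdSimplex fun _ => fairCoin_mem_stdSimplex
  set u : Dist n := extendDist e (uniformPairs_mem_stdSimplex hh) with hu
  set p : (Fin h → Bool) → Dist n := fun z =>
    extendDist e (perturbed_mem_stdSimplex hh hε0 hε1 z) with hp
  have hpu : ∀ z i, u.1 i = 0 → (p z).1 i = 0 := fun z i hi =>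
    extendDist_eq_zero e _ fun ⟨c, hc⟩ => by
      rw [← hc, hu, extendDist_apply, uniformPairs] at hi
      exact absurd hi (by positivity)
  have habs : ∀ x, |acceptGiven T u u x| ≤ 1 := fun x => by
    have hx := acceptGiven_mem_unitInterval T u u x
    exact abs_le.2 ⟨by linarith [hx.1], hx.2⟩
  have hsecond := sq_expect_iidWeight_mixture_sub_le hcoins.2 (fun z => (p z).2.2) u.2 hpu habs
  simp only [← acceptProb_eq_expect_acceptGiven, hu, hp, weightedInner_inv_extendDist] at hsecond
  have hyes := (hT u u u).1 (self_mem_mixtures u)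
  have hno : expect coins (fun z => acceptProb T (p z) u u) ≤ 1 / 3 := by
    rw [← expect_const hcoins.2 (1 / 3)]
    exact expect_mono hcoins.1 fun z => by
      linarith [(hT (p z) u u).2 (isFar_extendDist_perturbed e hh hε0 hε1 z)]
  have hgap : (1 / 9 : ℝ) ≤ (expect coins (fun z => acceptProb T (p z) u u)
      - acceptProb T u u u) ^ 2 := by nlinarith
  exact (hgap.trans hsecond).trans
    (sub_le_sub_right (perturbed_second_moment_le hh hε0 hε1) 1)

theorem sqrt_div_sq_le_samples (hn : 2 ≤ n) (hε0 : 0 < ε) (hε1 : ε ≤ 1)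
    {T : Algorithm n m₀ m₁ m₂} (hT : IsMixtureTester ε T) :
    1 / 6 * (√(n : ℝ) / ε ^ 2) ≤ m₀ := by
  obtain ⟨h, hh, hle, hge⟩ : ∃ h : ℕ, h ≠ 0 ∧ h * 2 ≤ n ∧ n ≤ 3 * h :=
    ⟨n / 2, by omega, by omega, by omega⟩
  obtain ⟨e⟩ : Nonempty (Fin h × Bool ↪ Fin n) :=
    Function.Embedding.nonempty_of_card_le (by simpa using hle)
  have hn3 : (n : ℝ) ≤ 3 * h := by exact_mod_cast hge
  have hmoment := one_div_twenty_le_of_le_exp_sub_one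
    (one_div_nine_le_second_moment_sub_one hT e hh hε0.le hε1)
  rw [le_div_iff₀ (by positivity)] at hmoment
  have hsqrt : √(n : ℝ) ≤ 6 * ε ^ 2 * m₀ := by
    rw [Real.sqrt_le_left (by positivity)]
    nlinarith
  rw [← mul_div_assoc, div_le_iff₀ (by positivity)]
  linarith

end UniformityLowerBound

section FactorialSums

/-- The sum `∑ a ≤ L, f a / a!`, a truncated expectation with respect to the weights of a Poisson
variable with its mean divided out. -/
noncomputable def factorialSum (L : ℕ) (f : ℕ → ℝ) : ℝ :=
  ∑ a ∈ Finset.range (L + 1), 1 / (a.factorial : ℝ) * f a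

/-- The iterated `factorialSum` of a function of two counts. -/
noncomputable def cellSum (L : ℕ) (H : ℕ → ℕ → ℝ) : ℝ :=
  factorialSum L fun a => factorialSum L (H a)

variable {L : ℕ}

theorem factorialSum_mono {f g : ℕ → ℝ} (h : ∀ a, f a ≤ g a) :
    factorialSum L f ≤ factorialSum L g :=
  Finset.sum_le_sum fun a _ => mul_le_mul_of_nonneg_left (h a) (by positivity)

theorem factorialSum_nonneg {f : ℕ → ℝ} (hf : ∀ a, 0 ≤ f a) : 0 ≤ factorialSum L f :=
  Finset.sum_nonneg fun a _ => mul_nonneg (by positivity) (hf a)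

theorem factorialSum_const_mul (L : ℕ) (c : ℝ) (f : ℕ → ℝ) :
    factorialSum L (fun a => c * f a) = c * factorialSum L f := by
  simp only [factorialSum, Finset.mul_sum, mul_left_comm]

theorem factorialSum_mul_const (L : ℕ) (f : ℕ → ℝ) (c : ℝ) :
    factorialSum L (fun a => f a * c) = factorialSum L f * c := by
  simp only [factorialSum, Finset.sum_mul, mul_assoc]

theorem factorialSum_expect {Ω : Type*} [Fintype Ω] (L : ℕ) (μ : Ω → ℝ) (f : Ω → ℕ → ℝ) :
    factorialSum L (fun a => expect μ fun u => f u a) = expect μ fun u => factorialSum L (f u) := by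
  simp only [factorialSum, expect_sum, expect_const_mul]

theorem factorialSum_pow_le_exp {r : ℝ} (hr : 0 ≤ r) (L : ℕ) :
    factorialSum L (fun a => r ^ a) ≤ Real.exp r := by
  simpa only [factorialSum, one_div_mul_eq_div] using Real.sum_le_exp_of_nonneg hr (L + 1)

theorem cellSum_nonneg {H : ℕ → ℕ → ℝ} (hH : ∀ a b, 0 ≤ H a b) : 0 ≤ cellSum L H :=
  factorialSum_nonneg fun a => factorialSum_nonneg (hH a)

theorem cellSum_sq_div {F : ℕ → ℕ → ℝ} (hF : ∀ a b, F a b ≠ 0) (G : ℕ → ℕ → ℝ) (L : ℕ) :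
    cellSum L (fun a b => G a b ^ 2 / F a b) = 2 * cellSum L G - cellSum L F
      + cellSum L fun a b => (G a b - F a b) ^ 2 / F a b := by
  simp only [cellSum, factorialSum, Finset.mul_sum, ← Finset.sum_sub_distrib,
    ← Finset.sum_add_distrib]
  refine Finset.sum_congr rfl fun a _ => Finset.sum_congr rfl fun b _ => ?_
  have := hF a b
  field_simp
  ring

end FactorialSums

section Lists

/-- Sequences of length at most `L`, the truncated realisations of a Poisson process on `α`. -/
abbrev Lists (α : Type*) (L : ℕ) : Type _ := Σ N : Fin (L + 1), Fin N → α

variable {α : Type*} {L : ℕ}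

/-- The weight `1 / N!` of a sequence of length `N`. -/
noncomputable def listWeight (ξ : Lists α L) : ℝ := 1 / (ξ.1.1.factorial : ℝ)

theorem listWeight_pos (ξ : Lists α L) : 0 < listWeight ξ := by
  unfold listWeight
  positivity

theorem expect_listWeight [Fintype α] (F : ∀ N, (Fin N → α) → ℝ) :
    expect (listWeight (L := L)) (fun ξ => F ξ.1 ξ.2) = factorialSum L fun N => ∑ x, F N x := by
  rw [expect, Fintype.sum_sigma, factorialSum]
  simp only [listWeight, ← Finset.mul_sum]
  exact Fin.sum_univ_eq_sum_range (fun N => 1 / (N.factorial : ℝ) * ∑ x, F N x) (L + 1)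

end Lists

section Counts

variable {α : Type*} [Fintype α]

theorem prod_one_div_factorial_nonneg (c : α → ℕ) : 0 ≤ ∏ i, 1 / ((c i).factorial : ℝ) :=
  Finset.prod_nonneg fun i _ => by positivity

variable [DecidableEq α]

/-- The number of occurrences of `i` in the sequence `x`. -/
def counts {N : ℕ} (x : Fin N → α) (i : α) : ℕ := (Finset.univ.filter fun j => x j = i).card

theorem prod_eq_prod_pow_counts {R : Type*} [CommMonoid R] {N : ℕ} (r : α → R) (x : Fin N → α) :
    ∏ j, r (x j) = ∏ i, r i ^ counts x i := by
  rw [← Finset.prod_fiberwise _ x]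
  refine Finset.prod_congr rfl fun i _ => ?_
  rw [counts, ← Finset.prod_const]
  exact Finset.prod_congr rfl fun j hj => by rw [(Finset.mem_filter.1 hj).2]

/-- Both sides arise by applying the linear map `X ^ c ↦ g c` to the two expansions of
`(∑ i, X i) ^ N`. -/
theorem sum_counts (N : ℕ) (g : (α → ℕ) → ℝ) :
    ∑ x : Fin N → α, g (counts x)
      = ∑ c ∈ Finset.univ.piAntidiag N, (Nat.multinomial Finset.univ c : ℝ) * g c := by
  have hmonomial : ∀ c : α → ℕ, ∏ i, (MvPolynomial.X i : MvPolynomial α ℝ) ^ c i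
      = MvPolynomial.monomial (Finsupp.equivFunOnFinite.symm c) 1 := fun c => by
    rw [MvPolynomial.monomial_eq, Finsupp.prod_fintype _ _ fun i => pow_zero _]
    simp
  set Λ := (MvPolynomial.basisMonomials α ℝ).constr ℝ
    fun s : α →₀ ℕ => g (Finsupp.equivFunOnFinite s)
  have hΛ : ∀ c : α → ℕ,
      Λ (MvPolynomial.monomial (Finsupp.equivFunOnFinite.symm c) 1) = g c := fun c => by
    have hbasis := (MvPolynomial.basisMonomials α ℝ).constr_basis ℝ
      (fun s : α →₀ ℕ => g (Finsupp.equivFunOnFinite s)) (Finsupp.equivFunOnFinite.symm c)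
    rwa [MvPolynomial.coe_basisMonomials, Equiv.apply_symm_apply] at hbasis
  have hexpand := Finset.sum_pow_eq_sum_piAntidiag (Finset.univ : Finset α)
    (fun i => (MvPolynomial.X i : MvPolynomial α ℝ)) N
  simp only [Fintype.sum_pow, prod_eq_prod_pow_counts, hmonomial] at hexpand
  simpa only [map_sum, ← nsmul_eq_mul, map_nsmul, hΛ] using congrArg Λ hexpand

/-- The sum of `g c / ∏ i, (c i)!` over all count vectors `c` with entries at most `L`. -/
noncomputable def boxSum (L : ℕ) (g : (α → ℕ) → ℝ) : ℝ :=
  ∑ c ∈ Fintype.piFinset fun _ => Finset.range (L + 1), (∏ i, 1 / ((c i).factorial : ℝ)) * g c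

variable {L : ℕ} {g : (α → ℕ) → ℝ}

theorem one_div_factorial_mul_sum_counts (N : ℕ) (g : (α → ℕ) → ℝ) :
    1 / (N.factorial : ℝ) * ∑ x : Fin N → α, g (counts x)
      = ∑ c ∈ Finset.univ.piAntidiag N, (∏ i, 1 / ((c i).factorial : ℝ)) * g c := by
  rw [sum_counts, Finset.mul_sum]
  refine Finset.sum_congr rfl fun c hc => ?_
  have hspec : (∏ i, ((c i).factorial : ℝ)) * (Nat.multinomial Finset.univ c : ℝ)
      = (N.factorial : ℝ) := by
    have h := Nat.multinomial_spec Finset.univ c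
    rw [(Finset.mem_piAntidiag.1 hc).1] at h
    exact_mod_cast h
  have hprod : ∏ i, ((c i).factorial : ℝ) ≠ 0 := Finset.prod_ne_zero_iff.2 fun i _ => by positivity
  rw [Finset.prod_div_distrib, Finset.prod_const_one, ← mul_assoc]
  congr 1
  rw [one_div_mul_eq_div, div_eq_div_iff (by positivity) hprod, one_mul, mul_comm, hspec]

theorem expect_listWeight_counts_le_boxSum (hg : ∀ c, 0 ≤ g c) :
    expect (listWeight (L := L)) (fun ξ => g (counts ξ.2)) ≤ boxSum L g := by
  have hnn : ∀ c : α → ℕ, 0 ≤ (∏ i, 1 / ((c i).factorial : ℝ)) * g c := fun c =>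
    mul_nonneg (prod_one_div_factorial_nonneg c) (hg c)
  rw [expect_listWeight fun _ x => g (counts x), factorialSum]
  simp only [one_div_factorial_mul_sum_counts]
  refine (Finset.sum_le_sum fun N hN => Finset.sum_le_sum_of_subset_of_nonneg
    (t := (Fintype.piFinset fun _ : α => Finset.range (L + 1)).filter fun c => ∑ i, c i = N)
    (fun c hc => ?_) fun c _ _ => hnn c).trans
    (Finset.sum_fiberwise_le_sum_of_sum_fiber_nonneg fun N _ => Finset.sum_nonneg fun c _ => hnn c)
  have hcN : ∑ i, c i = N := (Finset.mem_piAntidiag.1 hc).1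
  refine Finset.mem_filter.2 ⟨Fintype.mem_piFinset.2 fun i => ?_, hcN⟩
  have hci : c i ≤ N := hcN ▸ Finset.single_le_sum (fun _ _ => Nat.zero_le _) (Finset.mem_univ i)
  exact Finset.mem_range.2 (hci.trans_lt (Finset.mem_range.1 hN))

theorem boxSum_nonneg (hg : ∀ c, 0 ≤ g c) : 0 ≤ boxSum L g :=
  Finset.sum_nonneg fun c _ => mul_nonneg (prod_one_div_factorial_nonneg c) (hg c)

theorem boxSum_mono_left {L' : ℕ} (hL : L ≤ L') (hg : ∀ c, 0 ≤ g c) : boxSum L g ≤ boxSum L' g :=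
  Finset.sum_le_sum_of_subset_of_nonneg
    (Fintype.piFinset_subset _ _ fun _ => Finset.range_subset_range.2 (by omega))
    fun c _ _ => mul_nonneg (prod_one_div_factorial_nonneg c) (hg c)

theorem boxSum_prod (f : α → ℕ → ℝ) :
    boxSum L (fun c => ∏ i, f i (c i)) = ∏ i, factorialSum L (f i) := by
  simp only [boxSum, factorialSum, Finset.prod_univ_sum, Finset.prod_mul_distrib]

theorem boxSum_boxSum_prod (H : α → ℕ → ℕ → ℝ) :
    boxSum L (fun c => boxSum L fun d => ∏ i, H i (c i) (d i)) = ∏ i, cellSum L (H i) := by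
  simp only [boxSum_prod fun i => H i _, cellSum]
  exact boxSum_prod fun i a => factorialSum L (H i a)

theorem boxSum_boxSum_sq_prod_sub_prod_div {F : α → ℕ → ℕ → ℝ} (hF : ∀ i a b, F i a b ≠ 0)
    (G : α → ℕ → ℕ → ℝ) :
    boxSum L (fun c => boxSum L fun d =>
        (∏ i, G i (c i) (d i) - ∏ i, F i (c i) (d i)) ^ 2 / ∏ i, F i (c i) (d i))
      = (∏ i, cellSum L fun a b => G i a b ^ 2 / F i a b) - 2 * ∏ i, cellSum L (G i)
        + ∏ i, cellSum L (F i) := by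
  have hexpand : ∀ c d : α → ℕ,
      (∏ i, G i (c i) (d i) - ∏ i, F i (c i) (d i)) ^ 2 / ∏ i, F i (c i) (d i)
        = ∏ i, G i (c i) (d i) ^ 2 / F i (c i) (d i) - 2 * ∏ i, G i (c i) (d i)
          + ∏ i, F i (c i) (d i) := fun c d => by
    have := Finset.prod_ne_zero_iff.2 fun i (_ : i ∈ Finset.univ) => hF i (c i) (d i)
    rw [Finset.prod_div_distrib, Finset.prod_pow]
    field_simp
    ring
  simp only [hexpand, ← boxSum_boxSum_prod]
  simp only [boxSum, mul_add, mul_sub, Finset.mul_sum, Finset.sum_add_distrib,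
    Finset.sum_sub_distrib, mul_left_comm _ (2 : ℝ)]

theorem expect_pairWeight_listWeight_counts_le_boxSum {g : (α → ℕ) → (α → ℕ) → ℝ}
    (hg : ∀ c d, 0 ≤ g c d) {L' : ℕ} (hL : L ≤ L') :
    expect (pairWeight (listWeight (L := L)) (listWeight (L := L)))
        (fun x => g (counts x.1.2) (counts x.2.2))
      ≤ boxSum L' fun c => boxSum L' fun d => g c d := by
  rw [expect_pairWeight]
  calc _ ≤ expect (listWeight (L := L)) fun ξ => boxSum L' fun d => g (counts ξ.2) d :=
        expect_mono (fun ξ => (listWeight_pos ξ).le) fun ξ =>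
          (expect_listWeight_counts_le_boxSum (hg _)).trans (boxSum_mono_left hL (hg _))
    _ ≤ boxSum L fun c => boxSum L' fun d => g c d :=
        expect_listWeight_counts_le_boxSum fun c => boxSum_nonneg (hg c)
    _ ≤ _ := boxSum_mono_left hL fun c => boxSum_nonneg (hg c)

end Counts

open Filter Topology

section Poisson

/-- The probability that a Poisson variable with mean `r` equals `a`, relative to `1 / a!`. -/
noncomputable def poissonLik (r : ℝ) (a : ℕ) : ℝ := Real.exp (-r) * r ^ a

/-- The probability that a Poisson variable with mean `r` is at most `L`. -/
noncomputable def poissonCdf (L : ℕ) (r : ℝ) : ℝ := factorialSum L (poissonLik r)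

/-- The probability that a Poisson variable with mean `r` lies between `m` and `L`. -/
noncomputable def poissonMid (m L : ℕ) (r : ℝ) : ℝ :=
  factorialSum L fun N => if m ≤ N then poissonLik r N else 0

theorem poissonLik_pos {r : ℝ} (hr : 0 < r) (a : ℕ) : 0 < poissonLik r a := by
  unfold poissonLik
  positivity

variable {L m : ℕ} {r : ℝ}

theorem poissonLik_nonneg (hr : 0 ≤ r) (a : ℕ) : 0 ≤ poissonLik r a := by
  unfold poissonLik
  positivity

theorem poissonCdf_nonneg (hr : 0 ≤ r) : 0 ≤ poissonCdf L r :=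
  factorialSum_nonneg (poissonLik_nonneg hr)

theorem poissonCdf_le_one (hr : 0 ≤ r) : poissonCdf L r ≤ 1 := by
  calc poissonCdf L r = Real.exp (-r) * factorialSum L fun a => r ^ a :=
        factorialSum_const_mul L _ _
    _ ≤ Real.exp (-r) * Real.exp r := by gcongr; exact factorialSum_pow_le_exp hr L
    _ = 1 := by rw [← Real.exp_add, neg_add_cancel, Real.exp_zero]

theorem tendsto_poissonCdf (r : ℝ) : Tendsto (fun L => poissonCdf L r) atTop (𝓝 1) := by
  have hexp : HasSum (fun a : ℕ => 1 / (a.factorial : ℝ) * poissonLik r a) 1 := by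
    have h := (NormedSpace.expSeries_div_hasSum_exp r).mul_left (Real.exp (-r))
    rw [← Real.exp_eq_exp_ℝ, ← Real.exp_add, neg_add_cancel, Real.exp_zero] at h
    refine h.congr_fun fun a => ?_
    rw [poissonLik]
    ring
  exact (tendsto_add_atTop_iff_nat 1).2 hexp.tendsto_sum_nat

theorem poissonMid_nonneg (hr : 0 ≤ r) : 0 ≤ poissonMid m L r :=
  factorialSum_nonneg fun N => ite_nonneg (poissonLik_nonneg hr N) le_rfl

theorem poissonMid_le_one (hr : 0 ≤ r) : poissonMid m L r ≤ 1 := by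
  refine (factorialSum_mono fun N => ?_).trans (poissonCdf_le_one (L := L) hr)
  split_ifs
  · exact le_rfl
  · exact poissonLik_nonneg hr N

/-- Chernoff's bound: `2 ^ (m - N) ≥ 1` on the event `N < m`. -/
theorem poissonCdf_sub_le_poissonMid (m L : ℕ) (hr : 0 ≤ r) :
    poissonCdf L r - 2 ^ m * Real.exp (-(r / 2)) ≤ poissonMid m L r := by
  have hpoint : ∀ N, poissonLik r N
      ≤ (if m ≤ N then poissonLik r N else 0) + 2 ^ m * Real.exp (-r) * (r / 2) ^ N := fun N => by
    split_ifs with h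
    · exact le_add_of_nonneg_right (by positivity)
    · have h2 : (1 : ℝ) ≤ 2 ^ m / 2 ^ N := by
        rw [one_le_div (by positivity)]
        exact pow_le_pow_right₀ one_le_two (by omega)
      calc poissonLik r N ≤ poissonLik r N * (2 ^ m / 2 ^ N) :=
            le_mul_of_one_le_right (poissonLik_nonneg hr N) h2
        _ = _ := by rw [poissonLik, div_pow]; ring
  have hsum := factorialSum_mono (L := L) hpoint
  have hadd : factorialSum L (fun N => (if m ≤ N then poissonLik r N else 0)
      + 2 ^ m * Real.exp (-r) * (r / 2) ^ N)
      = poissonMid m L r + 2 ^ m * Real.exp (-r) * factorialSum L fun N => (r / 2) ^ N := by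
    rw [← factorialSum_const_mul]
    simp only [poissonMid, factorialSum, mul_add, Finset.sum_add_distrib]
  have htail : 2 ^ m * Real.exp (-r) * factorialSum L (fun N => (r / 2) ^ N)
      ≤ 2 ^ m * Real.exp (-(r / 2)) := by
    calc _ ≤ 2 ^ m * Real.exp (-r) * Real.exp (r / 2) := by
          gcongr
          exact factorialSum_pow_le_exp (by positivity) L
      _ = _ := by
          rw [mul_assoc, ← Real.exp_add]
          ring_nf
  rw [hadd] at hsum
  change poissonCdf L r ≤ _ at hsum
  linarith

end Poisson

section PoissonMixture

variable {α τ : Type*} [Fintype α] [Fintype τ] {L : ℕ}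

/-- The probability that a Poisson process with rates `r` produces the sequence `ξ`. -/
noncomputable def poissonWeight (r : α → ℝ) (ξ : Lists α L) : ℝ :=
  listWeight ξ * (Real.exp (-∑ i, r i) * iidWeight r ξ.1 ξ.2)

/-- The probability that two conditionally independent Poisson processes produce the sequences
`x.1` and `x.2`, where the rates `r i u` and `s i u` of each `i` depend on a state `u` that is
drawn from `w` independently for each `i`. -/
noncomputable def poissonMixture [DecidableEq α] (w : τ → ℝ) (r s : α → τ → ℝ)
    (x : Lists α L × Lists α L) : ℝ :=
  expect (prodWeight fun _ : α => w) fun t =>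
    pairWeight (poissonWeight fun i => r i (t i)) (poissonWeight fun i => s i (t i)) x

/-- The probability that a single element with random rates `r u` and `s u` has the counts `a`
and `b`, relative to `1 / (a! b!)`. -/
noncomputable def cellLik (w r s : τ → ℝ) (a b : ℕ) : ℝ :=
  expect w fun u => poissonLik (r u) a * poissonLik (s u) b

theorem sum_iidWeight (r : α → ℝ) (N : ℕ) : ∑ x, iidWeight r N x = (∑ i, r i) ^ N := by
  simp only [iidWeight, prodWeight, Fintype.sum_pow]

theorem expect_poissonWeight (r : α → ℝ) (F : ∀ N, (Fin N → α) → ℝ) :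
    expect (poissonWeight (L := L) r) (fun ξ => F ξ.1 ξ.2)
      = factorialSum L fun N => Real.exp (-∑ i, r i) * expect (iidWeight r N) (F N) := by
  simp only [expect, Finset.mul_sum]
  rw [← expect_listWeight fun N x => Real.exp (-∑ i, r i) * (iidWeight r N x * F N x)]
  simp only [expect, poissonWeight, mul_assoc]

theorem sum_poissonWeight (r : α → ℝ) :
    ∑ ξ : Lists α L, poissonWeight r ξ = poissonCdf L (∑ i, r i) := by
  have h := expect_poissonWeight (L := L) r fun _ _ => 1
  simp only [expect, mul_one, sum_iidWeight] at h
  exact h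

theorem expect_poissonMixture [DecidableEq α] (w : τ → ℝ) (r s : α → τ → ℝ)
    (f : Lists α L × Lists α L → ℝ) :
    expect (poissonMixture w r s) f = expect (prodWeight fun _ : α => w) fun t =>
      expect (pairWeight (poissonWeight fun i => r i (t i)) (poissonWeight fun i => s i (t i)))
        f := by
  simp only [poissonMixture, expect, Finset.sum_mul, Finset.mul_sum, mul_assoc]
  exact Finset.sum_comm

variable {w : τ → ℝ}

theorem sum_poissonMixture_le_one [DecidableEq α] (hw : w ∈ stdSimplex ℝ τ) {r s : α → τ → ℝ}
    (hr : ∀ i u, 0 ≤ r i u) (hs : ∀ i u, 0 ≤ s i u) :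
    ∑ x, poissonMixture (L := L) w r s x ≤ 1 := by
  have hprior := prodWeight_mem_stdSimplex fun _ : α => hw
  have hone : ∀ r : α → ℝ, expect (poissonWeight (L := L) r) (fun _ => 1)
      = poissonCdf L (∑ i, r i) := fun r => by
    simp only [expect, mul_one, sum_poissonWeight]
  have hmass : ∑ x, poissonMixture (L := L) w r s x
      = expect (prodWeight fun _ : α => w) fun t =>
        poissonCdf L (∑ i, r i (t i)) * poissonCdf L (∑ i, s i (t i)) := by
    rw [← Finset.sum_congr rfl fun x _ => mul_one (poissonMixture w r s x)]
    refine (expect_poissonMixture w r s fun _ => 1).trans ?_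
    simp only [expect_pairWeight, hone]
    simp only [← expect_mul_const, ← hone, one_mul]
  rw [hmass]
  refine (expect_mono hprior.1 fun t => mul_le_one₀ ?_ ?_ ?_).trans_eq (expect_const hprior.2 1)
  · exact poissonCdf_le_one (Finset.sum_nonneg fun i _ => hr i (t i))
  · exact poissonCdf_nonneg (Finset.sum_nonneg fun i _ => hs i (t i))
  · exact poissonCdf_le_one (Finset.sum_nonneg fun i _ => hs i (t i))

theorem poissonWeight_eq_prod_poissonLik [DecidableEq α] (r : α → ℝ) (ξ : Lists α L) :
    poissonWeight r ξ = listWeight ξ * ∏ i, poissonLik (r i) (counts ξ.2 i) := by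
  simp only [poissonWeight, iidWeight, prodWeight, poissonLik, Finset.prod_mul_distrib,
    prod_eq_prod_pow_counts, ← Real.exp_sum, Finset.sum_neg_distrib]

theorem poissonMixture_eq_prod_cellLik [DecidableEq α] (w : τ → ℝ) (r s : α → τ → ℝ)
    (x : Lists α L × Lists α L) :
    poissonMixture w r s x = pairWeight listWeight listWeight x
      * ∏ i, cellLik w (r i) (s i) (counts x.1.2 i) (counts x.2.2 i) := by
  simp only [cellLik]
  rw [← expect_prodWeight_prod, ← expect_const_mul]
  simp only [poissonMixture, pairWeight, poissonWeight_eq_prod_poissonLik,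
    Finset.prod_mul_distrib, mul_mul_mul_comm]

theorem cellSum_cellLik (w r s : τ → ℝ) (L : ℕ) :
    cellSum L (cellLik w r s) = expect w fun u => poissonCdf L (r u) * poissonCdf L (s u) := by
  calc cellSum L (cellLik w r s) = factorialSum L fun a => factorialSum L fun b =>
        expect w fun u => poissonLik (r u) a * poissonLik (s u) b := rfl
    _ = _ := by
      simp only [factorialSum_expect, factorialSum_const_mul, factorialSum_mul_const]
      rfl

theorem tendsto_cellSum_cellLik (hw : ∑ u, w u = 1) (r s : τ → ℝ) :
    Tendsto (fun L => cellSum L (cellLik w r s)) atTop (𝓝 1) := by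
  simp only [cellSum_cellLik, expect]
  have h : Tendsto (fun L => ∑ u, w u * (poissonCdf L (r u) * poissonCdf L (s u))) atTop
      (𝓝 (∑ u, w u * (1 * 1))) :=
    tendsto_finsetSum _ fun u _ =>
      ((tendsto_poissonCdf (r u)).mul (tendsto_poissonCdf (s u))).const_mul (w u)
  simpa only [mul_one, hw] using h

theorem weightedInner_inv_poissonMixture_le [DecidableEq α] {r s : α → τ → ℝ}
    (hpos : ∀ i a b, 0 < cellLik w (r i) (s i) a b) (r' s' : α → τ → ℝ) {L' : ℕ} (hL : L ≤ L') :
    weightedInner (poissonMixture (L := L) w r s)⁻¹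
        (poissonMixture w r' s' - poissonMixture w r s)
        (poissonMixture w r' s' - poissonMixture w r s)
      ≤ (∏ i, cellSum L' fun a b => cellLik w (r' i) (s' i) a b ^ 2 / cellLik w (r i) (s i) a b)
        - 2 * ∏ i, cellSum L' (cellLik w (r' i) (s' i))
        + ∏ i, cellSum L' (cellLik w (r i) (s i)) := by
  rw [← boxSum_boxSum_sq_prod_sub_prod_div fun i a b => (hpos i a b).ne']
  refine le_trans (le_of_eq ?_) (expect_pairWeight_listWeight_counts_le_boxSum
    (fun c d => div_nonneg (sq_nonneg _) (Finset.prod_nonneg fun i _ => (hpos i _ _).le)) hL)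
  refine Finset.sum_congr rfl fun x _ => ?_
  have hweight : pairWeight (listWeight (L := L)) listWeight x ≠ 0 :=
    (mul_pos (listWeight_pos x.1) (listWeight_pos x.2)).ne'
  have hprod : ∏ i, cellLik w (r i) (s i) (counts x.1.2 i) (counts x.2.2 i) ≠ 0 :=
    (Finset.prod_pos fun i _ => hpos i _ _).ne'
  simp only [Pi.inv_apply, Pi.sub_apply, poissonMixture_eq_prod_cellLik]
  field_simp

theorem tendsto_prod_cellSum_cellLik (hw : ∑ u, w u = 1) (r s r' s' : α → τ → ℝ) (χ : ℝ) :
    Tendsto (fun L =>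
        (∏ i, (2 * cellSum L (cellLik w (r' i) (s' i)) - cellSum L (cellLik w (r i) (s i)) + χ))
          - 2 * ∏ i, cellSum L (cellLik w (r' i) (s' i)) + ∏ i, cellSum L (cellLik w (r i) (s i)))
      atTop (𝓝 ((1 + χ) ^ Fintype.card α - 1)) := by
  have hcell := fun r s : τ → ℝ => tendsto_cellSum_cellLik hw r s
  have hlim := (tendsto_finsetProd Finset.univ fun i _ =>
      (((hcell (r' i) (s' i)).const_mul 2).sub (hcell (r i) (s i))).add_const χ).sub
    ((tendsto_finsetProd Finset.univ fun i _ => hcell (r' i) (s' i)).const_mul 2)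
  convert hlim.add (tendsto_finsetProd Finset.univ fun i _ => hcell (r i) (s i)) using 2
  simp only [Finset.prod_const, Finset.card_univ, one_pow]
  ring

/-- Neither mixture is normalised, because the sequences are truncated at length `L`. Enlarging
`L` increases the chi-squared sum, and in the limit both normalisations become `1`. -/
theorem weightedInner_inv_poissonMixture_le_pow [DecidableEq α] (hw : ∑ u, w u = 1)
    {r s r' s' : α → τ → ℝ} (hpos : ∀ i a b, 0 < cellLik w (r i) (s i) a b) {χ : ℝ}
    (hχ : ∀ i L, cellSum L (fun a b => (cellLik w (r' i) (s' i) a b - cellLik w (r i) (s i) a b) ^ 2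
      / cellLik w (r i) (s i) a b) ≤ χ) (L : ℕ) :
    weightedInner (poissonMixture (L := L) w r s)⁻¹
        (poissonMixture w r' s' - poissonMixture w r s)
        (poissonMixture w r' s' - poissonMixture w r s) ≤ (1 + χ) ^ Fintype.card α - 1 := by
  refine ge_of_tendsto (tendsto_prod_cellSum_cellLik hw r s r' s' χ)
    (eventually_atTop.2 ⟨L, fun L' hL => ?_⟩)
  refine (weightedInner_inv_poissonMixture_le hpos r' s' hL).trans
    (add_le_add_left (sub_le_sub_right (Finset.prod_le_prod (fun i _ => ?_) fun i _ => ?_) _) _)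
  · exact cellSum_nonneg fun a b => div_nonneg (sq_nonneg _) (hpos i a b).le
  · rw [cellSum_sq_div fun a b => (hpos i a b).ne']
    gcongr
    exact hχ i L'

theorem sq_expect_poissonMixture_sub_le [DecidableEq α] (hw : w ∈ stdSimplex ℝ τ)
    {r s r' s' : α → τ → ℝ} (hr : ∀ i u, 0 ≤ r i u) (hs : ∀ i u, 0 ≤ s i u)
    (hpos : ∀ i a b, 0 < cellLik w (r i) (s i) a b) {χ : ℝ}
    (hχ : ∀ i L, cellSum L (fun a b => (cellLik w (r' i) (s' i) a b - cellLik w (r i) (s i) a b) ^ 2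
      / cellLik w (r i) (s i) a b) ≤ χ)
    {f : Lists α L × Lists α L → ℝ} (hf : ∀ x, |f x| ≤ 1) :
    (expect (poissonMixture w r' s') f - expect (poissonMixture w r s) f) ^ 2
      ≤ (1 + χ) ^ Fintype.card α - 1 := by
  have hmix : ∀ x, 0 < poissonMixture (L := L) w r s x := fun x => by
    rw [poissonMixture_eq_prod_cellLik]
    exact mul_pos (mul_pos (listWeight_pos x.1) (listWeight_pos x.2))
      (Finset.prod_pos fun i _ => hpos i _ _)
  refine (sq_expect_sub_expect_le (fun x => (hmix x).le) (fun x hx => absurd hx (hmix x).ne')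
    hf).trans ((mul_le_of_le_one_left ?_ (sum_poissonMixture_le_one hw hr hs)).trans
      (weightedInner_inv_poissonMixture_le_pow hw.2 hpos hχ L))
  exact Finset.sum_nonneg fun x _ => mul_nonneg (inv_nonneg.2 (hmix x).le) (mul_self_nonneg _)

end PoissonMixture

section Prefix

variable {α : Type*} {L m : ℕ}

/-- The value of `φ` at the first `m` terms of `ξ`, or `0` when `ξ` is shorter than `m`. -/
noncomputable def onPrefix (φ : (Fin m → α) → ℝ) (ξ : Lists α L) : ℝ :=
  if h : m ≤ ξ.1 then φ (ξ.2 ∘ Fin.castLE h) else 0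

theorem onPrefix_mem_unitInterval {φ : (Fin m → α) → ℝ} (hφ : ∀ x, φ x ∈ Set.Icc (0 : ℝ) 1)
    (ξ : Lists α L) : onPrefix φ ξ ∈ Set.Icc (0 : ℝ) 1 := by
  unfold onPrefix
  split_ifs with h
  · exact hφ _
  · exact ⟨le_rfl, zero_le_one⟩

variable [Fintype α]

theorem expect_iidWeight_comp_castLE {N : ℕ} (h : m ≤ N) (r : α → ℝ) (φ : (Fin m → α) → ℝ) :
    expect (iidWeight r N) (fun x => φ (x ∘ Fin.castLE h))
      = (∑ i, r i) ^ (N - m) * expect (iidWeight r m) φ := by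
  obtain ⟨k, rfl⟩ := Nat.exists_eq_add_of_le h
  have happend : ∀ (x : Fin m → α) (y : Fin k → α), Fin.append x y ∘ Fin.castLE h = x :=
    fun x y => funext fun j => Fin.append_left x y j
  simp only [expect_iidWeight_add, happend, Nat.add_sub_cancel_left, ← expect_const_mul]
  simp only [expect, ← Finset.sum_mul, sum_iidWeight]

theorem expect_iidWeight_div (c : ℝ) (r : α → ℝ) (φ : (Fin m → α) → ℝ) :
    expect (iidWeight (fun i => r i / c) m) φ = expect (iidWeight r m) φ / c ^ m := by
  simp only [expect, iidWeight, prodWeight, Finset.prod_div_distrib, Finset.prod_const,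
    Finset.card_univ, Fintype.card_fin, Finset.sum_div, div_mul_eq_mul_div]

theorem expect_poissonWeight_onPrefix {r : α → ℝ} (hr : 0 < ∑ i, r i) (φ : (Fin m → α) → ℝ) :
    expect (poissonWeight (L := L) r) (onPrefix φ)
      = poissonMid m L (∑ i, r i) * expect (iidWeight (fun i => r i / ∑ j, r j) m) φ := by
  have h := expect_poissonWeight (L := L) r fun N x =>
    if h : m ≤ N then φ (x ∘ Fin.castLE h) else 0
  refine h.trans ?_
  rw [poissonMid, ← factorialSum_mul_const, expect_iidWeight_div]
  congr 1
  ext N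
  split_ifs with hN
  · rw [expect_iidWeight_comp_castLE hN, poissonLik, ← pow_sub_mul_pow _ hN]
    field_simp
  · simp only [expect, mul_zero, Finset.sum_const_zero, zero_mul]

end Prefix

section HeavyLight

/-- The prior of the state of an element: the first component says that the element is heavy, which
has probability `ρ`, and the second one is an independent fair coin. -/
noncomputable def prior (ρ : ℝ) : Bool × Bool → ℝ :=
  pairWeight (fun heavy => if heavy then ρ else 1 - ρ) fairCoin

variable {n : ℕ} [NeZero n]

/-- The common rates of both distributions in the close case: the element `0` has rate `M`, and
every other element has rate `1` or `l` according to whether it is heavy or light. -/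
noncomputable def closeRate (M l : ℝ) (i : Fin n) (u : Bool × Bool) : ℝ :=
  if i = 0 then M else if u.1 then 1 else l

/-- The rates of the distributions `b = true` and `b = false` in the far case. They are those of
the close case, except that each light element has rate `2 * l` in the distribution named by its
coin and rate `0` in the other one. -/
noncomputable def farRate (M l : ℝ) (b : Bool) (i : Fin n) (u : Bool × Bool) : ℝ :=
  if i = 0 then M else if u.1 then 1 else if u.2 = b then 2 * l else 0

variable {M l ρ : ℝ}

theorem prior_mem_stdSimplex (h0 : 0 ≤ ρ) (h1 : ρ ≤ 1) : prior ρ ∈ stdSimplex ℝ (Bool × Bool) := by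
  refine pairWeight_mem_stdSimplex ⟨fun heavy => ?_, ?_⟩ fairCoin_mem_stdSimplex
  · exact ite_nonneg h0 (sub_nonneg.2 h1)
  · simp

theorem closeRate_nonneg (hM : 0 ≤ M) (hl : 0 ≤ l) (i : Fin n) (u : Bool × Bool) :
    0 ≤ closeRate M l i u :=
  ite_nonneg hM (ite_nonneg zero_le_one hl)

theorem farRate_nonneg (hM : 0 ≤ M) (hl : 0 ≤ l) (b : Bool) (i : Fin n) (u : Bool × Bool) :
    0 ≤ farRate M l b i u :=
  ite_nonneg hM (ite_nonneg zero_le_one (ite_nonneg (by positivity) le_rfl))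

theorem le_sum_closeRate (hM : 0 ≤ M) (hl : 0 ≤ l) (t : Fin n → Bool × Bool) :
    M ≤ ∑ i, closeRate M l i (t i) :=
  (if_pos rfl).ge.trans (Finset.single_le_sum (fun i _ => closeRate_nonneg hM hl i (t i))
    (Finset.mem_univ (0 : Fin n)))

theorem le_sum_farRate (hM : 0 ≤ M) (hl : 0 ≤ l) (b : Bool) (t : Fin n → Bool × Bool) :
    M ≤ ∑ i, farRate M l b i (t i) :=
  (if_pos rfl).ge.trans (Finset.single_le_sum (fun i _ => farRate_nonneg hM hl b i (t i))
    (Finset.mem_univ (0 : Fin n)))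

end HeavyLight

section ChiSquared

variable {n : ℕ} [NeZero n] {M l ρ : ℝ}

theorem factorialSum_le_three_mul {f : ℕ → ℝ} {c : ℝ} (hc : 0 ≤ c) (hf : ∀ a, f a ≤ c) (L : ℕ) :
    factorialSum L f ≤ 3 * c := by
  calc factorialSum L f ≤ factorialSum L fun a => 1 ^ a * c :=
        factorialSum_mono fun a => by simpa only [one_pow, one_mul] using hf a
    _ = factorialSum L (fun a => 1 ^ a) * c := factorialSum_mul_const L _ c
    _ ≤ 3 * c := by
        gcongr
        linarith [factorialSum_pow_le_exp zero_le_one L, Real.exp_one_lt_d9]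

theorem cellSum_le_nine_mul {H : ℕ → ℕ → ℝ} {c : ℝ} (hc : 0 ≤ c) (hH : ∀ a b, H a b ≤ c) (L : ℕ) :
    cellSum L H ≤ 9 * c := by
  have h := factorialSum_le_three_mul (by positivity)
    (fun a => factorialSum_le_three_mul hc (hH a) L) L
  unfold cellSum
  linarith

theorem abs_half_two_mul_pow_sub_pow_le (hl0 : 0 ≤ l) (hl1 : 2 * l ≤ 1) {c : ℕ} (hc : 2 ≤ c) :
    |(2 * l) ^ c / 2 - l ^ c| ≤ 4 * l ^ 2 := by
  have h2 : (2 * l) ^ c ≤ (2 * l) ^ 2 := pow_le_pow_of_le_one (by positivity) hl1 hc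
  have h1 : l ^ c ≤ l ^ 2 := pow_le_pow_of_le_one hl0 (by linarith) hc
  have h2' : 0 ≤ (2 * l) ^ c := by positivity
  have h1' : 0 ≤ l ^ c := by positivity
  rw [abs_le]
  constructor <;> linarith

/-- The moments agree when `a + b ≤ 1`: one sample from each distribution carries no information,
and only collisions do. -/
theorem abs_light_moment_sub_le (hl0 : 0 ≤ l) (hl1 : 2 * l ≤ 1) (a b : ℕ) :
    |((2 * l) ^ a * 0 ^ b + 0 ^ a * (2 * l) ^ b) / 2 - l ^ a * l ^ b| ≤ 4 * l ^ 2 := by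
  have hsq : 0 ≤ 4 * l ^ 2 := by positivity
  rcases a.eq_zero_or_pos with rfl | ha <;> rcases b.eq_zero_or_pos with rfl | hb
  · simpa using hsq
  · rcases Nat.eq_or_lt_of_le hb with rfl | hb
    · simpa using hsq
    · simpa [(Nat.zero_lt_of_lt hb).ne'] using abs_half_two_mul_pow_sub_pow_le hl0 hl1 hb
  · rcases Nat.eq_or_lt_of_le ha with rfl | ha
    · simpa using hsq
    · simpa [(Nat.zero_lt_of_lt ha).ne'] using abs_half_two_mul_pow_sub_pow_le hl0 hl1 ha
  · rw [zero_pow ha.ne', zero_pow hb.ne', ← pow_add, mul_zero, zero_mul, add_zero, zero_div,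
      zero_sub, abs_neg, abs_of_nonneg (by positivity)]
    linarith [pow_le_pow_of_le_one hl0 (by linarith) (by omega : 2 ≤ a + b), sq_nonneg l]

theorem expect_prior (ρ : ℝ) (f : Bool × Bool → ℝ) :
    expect (prior ρ) f = ρ * ((f (true, true) + f (true, false)) / 2)
      + (1 - ρ) * ((f (false, true) + f (false, false)) / 2) := by
  rw [prior, expect_pairWeight]
  simp only [expect, fairCoin, Fintype.sum_bool, if_true,
    Bool.false_eq_true, if_false]
  ring

theorem cellLik_closeRate {i : Fin n} (hi : i ≠ 0) (M l ρ : ℝ) (a b : ℕ) :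
    cellLik (prior ρ) (closeRate M l i) (closeRate M l i) a b
      = ρ * Real.exp (-2) + (1 - ρ) * Real.exp (-(2 * l)) * (l ^ a * l ^ b) := by
  have hl : Real.exp (-(2 * l)) = Real.exp (-l) * Real.exp (-l) := by
    rw [← Real.exp_add]; ring_nf
  have h1 : Real.exp (-2) = Real.exp (-1) * Real.exp (-1) := by
    rw [← Real.exp_add]; norm_num
  simp only [cellLik, expect_prior, closeRate, hi, poissonLik, if_true, if_false,
    Bool.false_eq_true, one_pow, hl, h1]
  ring

theorem cellLik_farRate {i : Fin n} (hi : i ≠ 0) (M l ρ : ℝ) (a b : ℕ) :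
    cellLik (prior ρ) (farRate M l true i) (farRate M l false i) a b
      = ρ * Real.exp (-2) + (1 - ρ) * Real.exp (-(2 * l)) *
        (((2 * l) ^ a * 0 ^ b + 0 ^ a * (2 * l) ^ b) / 2) := by
  have h1 : Real.exp (-2) = Real.exp (-1) * Real.exp (-1) := by
    rw [← Real.exp_add]; norm_num
  simp only [cellLik, expect_prior, farRate, hi, poissonLik, if_true, if_false, reduceCtorEq,
    Bool.false_eq_true, one_pow, neg_zero, Real.exp_zero, h1]
  ring

theorem cellLik_closeRate_pos (hM : 0 < M) (hl : 0 ≤ l) (hρ0 : 0 < ρ) (hρ1 : ρ ≤ 1) (i : Fin n)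
    (a b : ℕ) : 0 < cellLik (prior ρ) (closeRate M l i) (closeRate M l i) a b := by
  have := sub_nonneg.2 hρ1
  by_cases hi : i = 0
  · simp only [cellLik, closeRate, hi, if_true,
      expect_const (prior_mem_stdSimplex hρ0.le hρ1).2]
    exact mul_pos (poissonLik_pos hM a) (poissonLik_pos hM b)
  · rw [cellLik_closeRate hi]
    positivity

theorem div_nine_le_cellLik_closeRate (hl : 0 ≤ l) (hρ0 : 0 ≤ ρ) (hρ1 : ρ ≤ 1) {i : Fin n}
    (hi : i ≠ 0) (a b : ℕ) :
    ρ / 9 ≤ cellLik (prior ρ) (closeRate M l i) (closeRate M l i) a b := by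
  have hexp : 1 / 9 ≤ Real.exp (-2) := by
    have h : Real.exp 2 ≤ 9 := by
      calc Real.exp 2 = Real.exp 1 ^ 2 := by rw [← Real.exp_nat_mul]; norm_num
        _ ≤ 3 ^ 2 := by gcongr; linarith [Real.exp_one_lt_d9]
        _ = 9 := by norm_num
    rw [Real.exp_neg, ← one_div]
    gcongr
  have hlight : 0 ≤ (1 - ρ) * Real.exp (-(2 * l)) * (l ^ a * l ^ b) := by
    have := sub_nonneg.2 hρ1
    positivity
  rw [cellLik_closeRate hi]
  linarith [mul_le_mul_of_nonneg_left hexp hρ0]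

theorem abs_cellLik_farRate_sub_closeRate_le (hl0 : 0 ≤ l) (hl1 : 2 * l ≤ 1) (hρ0 : 0 ≤ ρ)
    (hρ1 : ρ ≤ 1) {i : Fin n} (hi : i ≠ 0) (a b : ℕ) :
    |cellLik (prior ρ) (farRate M l true i) (farRate M l false i) a b
      - cellLik (prior ρ) (closeRate M l i) (closeRate M l i) a b| ≤ 4 * l ^ 2 := by
  have := sub_nonneg.2 hρ1
  rw [cellLik_farRate hi, cellLik_closeRate hi, add_sub_add_left_eq_sub, ← mul_sub, abs_mul,
    abs_of_nonneg (by positivity)]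
  refine (mul_le_of_le_one_left (abs_nonneg _) ?_).trans (abs_light_moment_sub_le hl0 hl1 a b)
  exact mul_le_one₀ (by linarith) (Real.exp_pos _).le (Real.exp_le_one_iff.2 (by linarith))

theorem cellSum_chiSq_le (hl0 : 0 ≤ l) (hl1 : 2 * l ≤ 1) (hρ0 : 0 < ρ) (hρ1 : ρ ≤ 1)
    (i : Fin n) (L : ℕ) :
    cellSum L (fun a b => (cellLik (prior ρ) (farRate M l true i) (farRate M l false i) a b
        - cellLik (prior ρ) (closeRate M l i) (closeRate M l i) a b) ^ 2
      / cellLik (prior ρ) (closeRate M l i) (closeRate M l i) a b) ≤ 1296 * l ^ 4 / ρ := by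
  have hval : 9 * ((4 * l ^ 2) ^ 2 / (ρ / 9)) = 1296 * l ^ 4 / ρ := by field_simp; ring
  rw [← hval]
  refine cellSum_le_nine_mul (by positivity) (fun a b => ?_) L
  by_cases hi : i = 0
  · have heq : cellLik (prior ρ) (farRate M l true i) (farRate M l false i) a b
        = cellLik (prior ρ) (closeRate M l i) (closeRate M l i) a b := by
      simp only [cellLik, farRate, closeRate, hi, if_true]
    rw [heq, sub_self, zero_pow two_ne_zero, zero_div]
    positivity
  · refine div_le_div₀ (by positivity) ?_ (by positivity)
      (div_nine_le_cellLik_closeRate hl0 hρ0.le hρ1 hi a b)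
    exact sq_le_sq.2 ((abs_cellLik_farRate_sub_closeRate_le hl0 hl1 hρ0.le hρ1 hi a b).trans
      (le_abs_self _))

end ChiSquared

section Normalisation

variable {n : ℕ}

/-- The distribution proportional to the rates `r`. -/
noncomputable def normDist (r : Fin n → ℝ) (hr : ∀ i, 0 ≤ r i) (hpos : 0 < ∑ i, r i) : Dist n :=
  ⟨fun i => r i / ∑ i, r i, fun i => div_nonneg (hr i) hpos.le, by
    rw [← Finset.sum_div, div_self hpos.ne']⟩

theorem l1Dist_comm (p q : Dist n) : l1Dist p q = l1Dist q p := by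
  simp only [l1Dist, abs_sub_comm]

theorem two_mul_sum_le_l1Dist (p q : Dist n) (A : Finset (Fin n)) (hq : ∀ i ∈ A, q.1 i = 0) :
    2 * ∑ i ∈ A, p.1 i ≤ l1Dist p q := by
  have hp1 := p.2.2
  have hq1 := q.2.2
  have hqA : ∑ i ∈ A, q.1 i = 0 := Finset.sum_eq_zero hq
  rw [← Finset.sum_add_sum_compl A] at hp1 hq1
  rw [l1Dist, ← Finset.sum_add_sum_compl A]
  have hA : ∑ i ∈ A, (p.1 i - q.1 i) ≤ ∑ i ∈ A, |p.1 i - q.1 i| :=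
    Finset.sum_le_sum fun i _ => le_abs_self _
  have hAc : ∑ i ∈ Aᶜ, (q.1 i - p.1 i) ≤ ∑ i ∈ Aᶜ, |p.1 i - q.1 i| :=
    Finset.sum_le_sum fun i _ => by rw [abs_sub_comm]; exact le_abs_self _
  rw [Finset.sum_sub_distrib] at hA hAc
  linarith

theorem le_l1Dist_normDist {r s : Fin n → ℝ} (hr : ∀ i, 0 ≤ r i) (hrpos : 0 < ∑ i, r i)
    (hs : ∀ i, 0 ≤ s i) (hspos : 0 < ∑ i, s i) (A : Finset (Fin n)) (hA : ∀ i ∈ A, s i = 0)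
    {c ε : ℝ} (hε0 : 0 ≤ ε) (hε1 : ε ≤ 1) (hc : ∑ i, r i ≤ c + ∑ i ∈ A, r i)
    (hεc : ε * c ≤ ∑ i ∈ A, r i) : ε ≤ l1Dist (normDist r hr hrpos) (normDist s hs hspos) := by
  have hzero : ∀ i ∈ A, (normDist s hs hspos).1 i = 0 := fun i hi =>
    (congrArg (· / ∑ i, s i) (hA i hi)).trans (zero_div _)
  refine le_trans ?_ (two_mul_sum_le_l1Dist _ _ A hzero)
  simp only [normDist]
  rw [← Finset.sum_div, ← mul_div_assoc, le_div_iff₀ hrpos]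
  have hAnonneg : 0 ≤ ∑ i ∈ A, r i := Finset.sum_nonneg fun i _ => hr i
  calc ε * ∑ i, r i ≤ ε * (c + ∑ i ∈ A, r i) := mul_le_mul_of_nonneg_left hc hε0
    _ = ε * c + ε * ∑ i ∈ A, r i := mul_add _ _ _
    _ ≤ ∑ i ∈ A, r i + 1 * ∑ i ∈ A, r i := by gcongr
    _ = 2 * ∑ i ∈ A, r i := by ring

end Normalisation

section Far

variable {n : ℕ}

/-- The number of heavy elements. -/
def heavyCount (t : Fin n → Bool × Bool) : ℝ := ∑ i, if (t i).1 then 1 else 0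

theorem heavyCount_nonneg (t : Fin n → Bool × Bool) : 0 ≤ heavyCount t :=
  Finset.sum_nonneg fun _ _ => ite_nonneg zero_le_one le_rfl

theorem expect_heavyCount {ρ : ℝ} (h0 : 0 ≤ ρ) (h1 : ρ ≤ 1) :
    expect (prodWeight fun _ : Fin n => prior ρ) heavyCount = n * ρ := by
  have hprior := (prior_mem_stdSimplex h0 h1).2
  have hheavy : expect (prior ρ) (fun u => if u.1 then 1 else 0) = ρ := by
    rw [expect_prior]
    norm_num
  have hsum := expect_sum (prodWeight fun _ : Fin n => prior ρ) Finset.univ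
    fun i t => if (t i).1 then 1 else 0
  refine hsum.trans ?_
  have hi := fun i => expect_prodWeight_apply (fun _ : Fin n => hprior) i
    fun u => if u.1 then 1 else 0
  simp only [hi, hheavy, Finset.sum_const, Finset.card_univ, Fintype.card_fin, nsmul_eq_mul]

variable [NeZero n]

/-- The light elements that belong to the distribution `b` in the far case. -/
def lightSet (t : Fin n → Bool × Bool) (b : Bool) : Finset (Fin n) :=
  Finset.univ.filter fun i => i ≠ 0 ∧ (t i).1 = false ∧ (t i).2 = b

theorem sum_lightSet_farRate (M l : ℝ) (t : Fin n → Bool × Bool) (b : Bool) :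
    ∑ i ∈ lightSet t b, farRate M l b i (t i) = (lightSet t b).card * (2 * l) := by
  rw [← nsmul_eq_mul]
  refine Finset.sum_eq_card_nsmul fun i hi => ?_
  obtain ⟨-, hi0, hlight, hcoin⟩ := Finset.mem_filter.1 hi
  simp [farRate, hi0, hlight, hcoin]

theorem farRate_eq_zero_of_mem_lightSet {t : Fin n → Bool × Bool} {b b' : Bool} (hb : b ≠ b')
    {i : Fin n} (hi : i ∈ lightSet t b) (M l : ℝ) : farRate M l b' i (t i) = 0 := by
  obtain ⟨-, hi0, hlight, hcoin⟩ := Finset.mem_filter.1 hi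
  simp [farRate, hi0, hlight, hcoin, hb]

theorem sum_farRate_le (M l : ℝ) (t : Fin n → Bool × Bool) (b : Bool) :
    ∑ i, farRate M l b i (t i)
      ≤ M + heavyCount t + ∑ i ∈ lightSet t b, farRate M l b i (t i) := by
  have hpoint : ∀ i, farRate M l b i (t i) ≤ (if i = 0 then M else 0)
      + (if (t i).1 then 1 else 0)
      + if i ≠ 0 ∧ (t i).1 = false ∧ (t i).2 = b then farRate M l b i (t i) else 0 := fun i => by
    by_cases hi : i = 0
    · simp only [farRate, hi]
      split_ifs <;> simp_all
    · by_cases hheavy : (t i).1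
      · simp [farRate, hi, hheavy]
      · by_cases hcoin : (t i).2 = b <;> simp [farRate, hi, hheavy, hcoin]
  refine (Finset.sum_le_sum fun i _ => hpoint i).trans_eq ?_
  rw [Finset.sum_add_distrib, Finset.sum_add_distrib, Finset.sum_ite_eq',
    if_pos (Finset.mem_univ _), heavyCount, lightSet,
    Finset.sum_filter fun i => i ≠ 0 ∧ (t i).1 = false ∧ (t i).2 = b]

theorem le_card_lightSet_add (t : Fin n → Bool × Bool) :
    (n : ℝ) ≤ 1 + heavyCount t + (lightSet t true).card + (lightSet t false).card := by
  have hpoint : ∀ i : Fin n, (1 : ℝ) ≤ (if i = 0 then 1 else 0) + (if (t i).1 then 1 else 0)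
      + (if i ≠ 0 ∧ (t i).1 = false ∧ (t i).2 = true then 1 else 0)
      + if i ≠ 0 ∧ (t i).1 = false ∧ (t i).2 = false then 1 else 0 := fun i => by
    by_cases hi : i = 0 <;> rcases t i with ⟨_ | _, _ | _⟩ <;> simp [hi]
  have hsum := Finset.sum_le_sum fun i (_ : i ∈ Finset.univ) => hpoint i
  simp only [Finset.sum_add_distrib] at hsum
  simpa [heavyCount, lightSet] using hsum

/-- The two light masses have sum at least `42 * ε * M`, so the larger one is at least `ε`
times the mass of the other elements, which is at most `21 * M`. -/
theorem isFar_farRate {N : ℕ} {M l ε : ℝ} {t : Fin (N + 1) → Bool × Bool} (hε0 : 0 ≤ ε)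
    (hε1 : ε ≤ 1) (hMN : 40 * M ≤ N) (hl : l * N = 42 * ε * M) (hl0 : 0 ≤ l)
    (ht : heavyCount t ≤ 20 * M)
    (hr : ∀ i, 0 ≤ farRate M l true i (t i)) (hrpos : 0 < ∑ i, farRate M l true i (t i))
    (hs : ∀ i, 0 ≤ farRate M l false i (t i)) (hspos : 0 < ∑ i, farRate M l false i (t i)) :
    IsFar ε (normDist _ hr hrpos) (mixtures (normDist _ hs hspos) (normDist _ hs hspos)) := by
  intro x hx
  rw [eq_of_mem_mixtures_self hx]
  have htotal : ∀ b, ∑ i, farRate M l b i (t i)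
      ≤ 21 * M + ∑ i ∈ lightSet t b, farRate M l b i (t i) := fun b =>
    (sum_farRate_le M l t b).trans (by linarith)
  have hlight : 42 * ε * M ≤ ∑ i ∈ lightSet t true, farRate M l true i (t i)
      + ∑ i ∈ lightSet t false, farRate M l false i (t i) := by
    have hcard := le_card_lightSet_add t
    push_cast at hcard
    rw [sum_lightSet_farRate, sum_lightSet_farRate, ← add_mul, ← hl]
    calc l * N = N / 2 * (2 * l) := by ring
      _ ≤ _ := by gcongr; linarith
  rcases le_total (∑ i ∈ lightSet t false, farRate M l false i (t i))
    (∑ i ∈ lightSet t true, farRate M l true i (t i)) with h | h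
  · exact le_l1Dist_normDist hr hrpos hs hspos _
      (fun i hi => farRate_eq_zero_of_mem_lightSet (by decide) hi M l) hε0 hε1
      (htotal true) (by linarith)
  · rw [l1Dist_comm]
    exact le_l1Dist_normDist hs hspos hr hrpos _
      (fun i hi => farRate_eq_zero_of_mem_lightSet (by decide) hi M l) hε0 hε1
      (htotal false) (by linarith)

end Far

section Poissonisation

variable {n m₀ m₁ m₂ L : ℕ}

/-- The acceptance probability of `T` when its last two inputs are the two parts of a single
sample `y` of size `m₁ + m₂`. -/
def pooledAccept (T : Algorithm n m₀ m₁ m₂) (x : Fin m₀ → Fin n) (y : Fin (m₁ + m₂) → Fin n) : ℝ :=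
  T x (fun j => y (Fin.castAdd m₂ j)) fun j => y (Fin.natAdd m₁ j)

/-- The acceptance probability of `T` when its inputs are the initial parts of two sequences of
random lengths, with rejection if one of them is too short. -/
noncomputable def poissonizedAccept (T : Algorithm n m₀ m₁ m₂)
    (x : Lists (Fin n) L × Lists (Fin n) L) : ℝ :=
  onPrefix (fun u => onPrefix (pooledAccept T u) x.2) x.1

variable (T : Algorithm n m₀ m₁ m₂)

theorem acceptProb_self_eq (p q : Dist n) :
    acceptProb T p q q = expect (iidWeight p.1 m₀) fun x =>
      expect (iidWeight q.1 (m₁ + m₂)) (pooledAccept T x) := by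
  rw [acceptProb_eq_expect_acceptGiven]
  simp only [expect_iidWeight_add, pooledAccept, Fin.append_left, Fin.append_right]
  rfl

theorem acceptProb_mem_unitInterval (p q₁ q₂ : Dist n) :
    acceptProb T p q₁ q₂ ∈ Set.Icc (0 : ℝ) 1 := by
  have hp := iidWeight_mem_stdSimplex p.2 m₀
  rw [acceptProb_eq_expect_acceptGiven]
  exact ⟨expect_nonneg hp.1 fun x => (acceptGiven_mem_unitInterval T q₁ q₂ x).1,
    (expect_mono hp.1 fun x => (acceptGiven_mem_unitInterval T q₁ q₂ x).2).trans_eq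
      (expect_const hp.2 1)⟩

theorem poissonizedAccept_mem_unitInterval (x : Lists (Fin n) L × Lists (Fin n) L) :
    poissonizedAccept T x ∈ Set.Icc (0 : ℝ) 1 :=
  onPrefix_mem_unitInterval (fun _ => onPrefix_mem_unitInterval (fun _ => (T _ _ _).2) x.2) x.1

variable {r s : Fin n → ℝ}

theorem expect_poissonizedAccept (hr : ∀ i, 0 ≤ r i) (hrpos : 0 < ∑ i, r i) (hs : ∀ i, 0 ≤ s i)
    (hspos : 0 < ∑ i, s i) :
    expect (pairWeight (poissonWeight (L := L) r) (poissonWeight s)) (poissonizedAccept T)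
      = poissonMid m₀ L (∑ i, r i) * poissonMid (m₁ + m₂) L (∑ i, s i)
        * acceptProb T (normDist r hr hrpos) (normDist s hs hspos) (normDist s hs hspos) := by
  rw [expect_pairWeight, expect_comm, acceptProb_self_eq]
  simp only [poissonizedAccept, expect_poissonWeight_onPrefix hrpos, expect_const_mul]
  rw [expect_comm]
  simp only [expect_poissonWeight_onPrefix hspos, expect_const_mul, normDist, mul_assoc]

theorem expect_poissonizedAccept_le_acceptProb (hr : ∀ i, 0 ≤ r i) (hrpos : 0 < ∑ i, r i)
    (hs : ∀ i, 0 ≤ s i) (hspos : 0 < ∑ i, s i) :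
    expect (pairWeight (poissonWeight (L := L) r) (poissonWeight s)) (poissonizedAccept T)
      ≤ acceptProb T (normDist r hr hrpos) (normDist s hs hspos) (normDist s hs hspos) := by
  rw [expect_poissonizedAccept T hr hrpos hs hspos]
  exact mul_le_of_le_one_left (acceptProb_mem_unitInterval T _ _ _).1
    (mul_le_one₀ (poissonMid_le_one hrpos.le) (poissonMid_nonneg hspos.le)
      (poissonMid_le_one hspos.le))

end Poissonisation

section Estimates

theorem two_pow_mul_exp_le {m m' : ℕ} (hm : 1 ≤ m) (hm' : m' ≤ m) {σ : ℝ} (hσ : 10 * (m : ℝ) ≤ σ) :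
    2 ^ m' * Real.exp (-(σ / 2)) ≤ 1 / 50 := by
  have hexp : (100 : ℝ) ≤ Real.exp 5 := by
    calc (100 : ℝ) ≤ 2.7 ^ 5 := by norm_num
      _ ≤ Real.exp 1 ^ 5 := by gcongr; linarith [Real.exp_one_gt_d9]
      _ = Real.exp 5 := by rw [← Real.exp_nat_mul]; norm_num
  calc 2 ^ m' * Real.exp (-(σ / 2)) ≤ 2 ^ m * Real.exp (m * (-5)) := by
        gcongr
        · norm_num
        · linarith
    _ = (2 * Real.exp (-5)) ^ m := by rw [mul_pow, Real.exp_nat_mul]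
    _ ≤ (2 * (1 / 100)) ^ m := by
        gcongr
        rw [Real.exp_neg, ← one_div]
        gcongr
    _ ≤ (2 * (1 / 100)) ^ 1 := pow_le_pow_of_le_one (by norm_num) (by norm_num) hm
    _ = 1 / 50 := by norm_num

theorem le_poissonMid {m m' L : ℕ} (hm : 1 ≤ m) (hm' : m' ≤ m) {σ : ℝ} (hσ : 10 * (m : ℝ) ≤ σ)
    (hL : 97 / 100 ≤ poissonCdf L σ) : 95 / 100 ≤ poissonMid m' L σ := by
  have hσ0 : 0 ≤ σ := le_trans (by positivity) hσ
  linarith [poissonCdf_sub_le_poissonMid m' L hσ0, two_pow_mul_exp_le hm hm' hσ]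

theorem one_add_pow_sub_one_le {χ : ℝ} {k : ℕ} (hχ : 0 ≤ χ) (h : k * χ ≤ 1 / 2) :
    (1 + χ) ^ k - 1 ≤ 2 * (k * χ) := by
  have hkχ : 0 ≤ k * χ := by positivity
  have hexp : (1 + χ) ^ k ≤ Real.exp (k * χ) := by
    rw [Real.exp_nat_mul]
    exact pow_le_pow_left₀ (by linarith) (by linarith [Real.add_one_le_exp χ]) k
  have hinv : Real.exp (k * χ) ≤ 1 / (1 - k * χ) :=
    Real.exp_bound_div_one_sub_of_interval hkχ (by linarith)
  have hfrac : 1 / (1 - k * χ) ≤ 1 + 2 * (k * χ) := by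
    rw [div_le_iff₀ (by linarith)]
    nlinarith
  linarith

/-- The left-hand side is the number of elements times the bound on the chi-squared distance of a
single element for `l = 42 * ε * M / N` and `ρ = M / N`, where `M = 10 * m`. -/
theorem total_chiSq_le {m N : ℕ} {ε : ℝ} (hm : 1 ≤ m) (hN : 1 ≤ N)
    (hmε : 10 ^ 16 * ((m : ℝ) ^ 3 * ε ^ 4) ≤ N ^ 2) :
    (N + 1 : ℕ) * (1296 * (42 * ε * (10 * m) / N) ^ 4 / (10 * m / N : ℝ)) ≤ 1 / 200 := by
  have : (0 : ℝ) < m := by exact_mod_cast hm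
  have hN1 : (1 : ℝ) ≤ N := by exact_mod_cast hN
  have hχ : 1296 * (42 * ε * (10 * m) / N) ^ 4 / (10 * m / N : ℝ)
      = 1296 * 42 ^ 4 * 1000 * (m ^ 3 * ε ^ 4) / N ^ 3 := by
    field_simp
    ring
  rw [hχ, ← mul_div_assoc, div_le_iff₀ (by positivity)]
  have hmε0 : 0 ≤ (m : ℝ) ^ 3 * ε ^ 4 := by positivity
  push_cast
  calc (N + 1 : ℝ) * (1296 * 42 ^ 4 * 1000 * ((m : ℝ) ^ 3 * ε ^ 4))
      ≤ 2 * N * (1 / 400 * (10 ^ 16 * ((m : ℝ) ^ 3 * ε ^ 4))) := by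
        gcongr ?_ * ?_ <;> linarith
    _ ≤ 2 * N * (1 / 400 * (N : ℝ) ^ 2) := by gcongr
    _ = 1 / 200 * (N : ℝ) ^ 3 := by ring

end Estimates

section HeavyLightMixtures

variable {N m₀ m₁ m₂ m L : ℕ} {ε M l ρ : ℝ}

theorem le_expect_poissonMixture_closeRate {T : Algorithm (N + 1) m₀ m₁ m₂}
    (hT : IsMixtureTester ε T) (hm : 1 ≤ m) (hm₀ : m₀ ≤ m) (hm₁₂ : m₁ + m₂ ≤ m)
    (hM : 10 * (m : ℝ) ≤ M) (hl : 0 ≤ l) (hρ0 : 0 ≤ ρ) (hρ1 : ρ ≤ 1)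
    (hL : ∀ t : Fin (N + 1) → Bool × Bool, 97 / 100 ≤ poissonCdf L (∑ i, closeRate M l i (t i))) :
    3 / 5 ≤ expect (poissonMixture (L := L) (prior ρ) (closeRate M l) (closeRate M l))
      (poissonizedAccept T) := by
  have hM0 : 0 < M := lt_of_lt_of_le (by positivity) hM
  have hprior := prodWeight_mem_stdSimplex fun _ : Fin (N + 1) => prior_mem_stdSimplex hρ0 hρ1
  rw [expect_poissonMixture, ← expect_const hprior.2 (3 / 5)]
  refine expect_mono hprior.1 fun t => ?_
  have hr := fun i => closeRate_nonneg hM0.le hl i (t i)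
  have hsum := le_sum_closeRate hM0.le hl t
  have hrpos := hM0.trans_le hsum
  rw [expect_poissonizedAccept T hr hrpos hr hrpos]
  have haccept := (hT (normDist _ hr hrpos) (normDist _ hr hrpos) (normDist _ hr hrpos)).1
    (self_mem_mixtures _)
  have hmid₀ := le_poissonMid hm hm₀ (hM.trans hsum) (hL t)
  have hmid₁₂ := le_poissonMid hm hm₁₂ (hM.trans hsum) (hL t)
  calc (3 / 5 : ℝ) ≤ 95 / 100 * (95 / 100) * (2 / 3) := by norm_num
    _ ≤ _ := by gcongr

theorem expect_poissonMixture_farRate_le {T : Algorithm (N + 1) m₀ m₁ m₂}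
    (hT : IsMixtureTester ε T) (hε0 : 0 ≤ ε) (hε1 : ε ≤ 1) (hM : 0 < M)
    (hMN : 40 * M ≤ N) (hN : 1 ≤ N) (hl : l * N = 42 * ε * M) (hl0 : 0 ≤ l)
    (hρ0 : 0 ≤ ρ) (hρ1 : ρ ≤ 1) (hρ : ρ * N = M) :
    expect (poissonMixture (L := L) (prior ρ) (farRate M l true) (farRate M l false))
      (poissonizedAccept T) ≤ 13 / 30 := by
  have hprior := prodWeight_mem_stdSimplex fun _ : Fin (N + 1) => prior_mem_stdSimplex hρ0 hρ1
  have hr := fun b (t : Fin (N + 1) → Bool × Bool) i => farRate_nonneg hM.le hl0 b i (t i)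
  have hrpos := fun b (t : Fin (N + 1) → Bool × Bool) =>
    hM.trans_le (le_sum_farRate hM.le hl0 b t)
  have haccept := fun t => expect_poissonizedAccept_le_acceptProb (L := L) T (hr true t)
    (hrpos true t) (hr false t) (hrpos false t)
  have hheavy : ((N + 1 : ℕ) * ρ) / (20 * M) ≤ 1 / 10 := by
    have hN1 : (1 : ℝ) ≤ N := by exact_mod_cast hN
    rw [div_le_iff₀ (by positivity), ← hρ]
    push_cast
    nlinarith
  rw [expect_poissonMixture]
  refine (expect_le_add_div (β := 1 / 3) (c := 20 * M) hprior (by norm_num) (by positivity)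
    (fun t => (haccept t).trans (acceptProb_mem_unitInterval T _ _ _).2) heavyCount_nonneg
    (fun t ht => ?_) (expect_heavyCount hρ0 hρ1).le).trans (by linarith)
  have hreject := (hT _ _ _).2 (isFar_farRate hε0 hε1 hMN hl hl0 ht (hr true t) (hrpos true t)
    (hr false t) (hrpos false t))
  linarith [haccept t]

theorem sq_expect_poissonMixture_farRate_sub_closeRate_le (T : Algorithm (N + 1) m₀ m₁ m₂)
    (hM : 0 < M) (hl0 : 0 ≤ l) (hl1 : 2 * l ≤ 1) (hρ0 : 0 < ρ) (hρ1 : ρ ≤ 1)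
    (hχ : (N + 1 : ℕ) * (1296 * l ^ 4 / ρ) ≤ 1 / 200) :
    (expect (poissonMixture (L := L) (prior ρ) (farRate M l true) (farRate M l false))
        (poissonizedAccept T)
      - expect (poissonMixture (L := L) (prior ρ) (closeRate M l) (closeRate M l))
        (poissonizedAccept T)) ^ 2 ≤ 1 / 100 := by
  have hclose := fun (i : Fin (N + 1)) u => closeRate_nonneg hM.le hl0 i u
  refine (sq_expect_poissonMixture_sub_le (prior_mem_stdSimplex hρ0.le hρ1) hclose hclose
    (fun i => cellLik_closeRate_pos hM hl0 hρ0 hρ1 i) (cellSum_chiSq_le hl0 hl1 hρ0 hρ1)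
    fun x => ?_).trans ?_
  · obtain ⟨h0, h1⟩ := poissonizedAccept_mem_unitInterval T x
    rwa [abs_of_nonneg h0]
  · rw [Fintype.card_fin]
    have hχ0 : 0 ≤ 1296 * l ^ 4 / ρ := by positivity
    linarith [one_add_pow_sub_one_le hχ0 (hχ.trans (by norm_num))]

end HeavyLightMixtures

section LowerBound

variable {N n m₀ m₁ m₂ m : ℕ} {ε : ℝ}

theorem not_isMixtureTester_of_few_samples (hε0 : 0 ≤ ε) (hε1 : ε ≤ 1) (hm : 1 ≤ m)
    (hm₀ : m₀ ≤ m) (hm₁₂ : m₁ + m₂ ≤ m) (hmN : 1000 * (m : ℝ) ≤ N)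
    (hmε : 10 ^ 16 * ((m : ℝ) ^ 3 * ε ^ 4) ≤ N ^ 2) (T : Algorithm (N + 1) m₀ m₁ m₂) :
    ¬ IsMixtureTester ε T := by
  intro hT
  have hm0 : (1 : ℝ) ≤ m := by exact_mod_cast hm
  have hN0 : (0 : ℝ) < N := by linarith
  have hN : 1 ≤ N := by exact_mod_cast hN0
  have hl0 : 0 ≤ 42 * ε * (10 * m) / N := by positivity
  have hl1 : 2 * (42 * ε * (10 * m) / N) ≤ 1 := by
    rw [← mul_div_assoc, div_le_one hN0]
    nlinarith
  have hρ0 : 0 < (10 * m / N : ℝ) := by positivity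
  have hρ1 : (10 * m / N : ℝ) ≤ 1 := by
    rw [div_le_one hN0]
    linarith
  have hlim : ∀ᶠ L in atTop, ∀ t : Fin (N + 1) → Bool × Bool, (97 / 100 : ℝ)
      < poissonCdf L (∑ i, closeRate (10 * m) (42 * ε * (10 * m) / N) i (t i)) :=
    eventually_all.2 fun t => (tendsto_poissonCdf _).eventually_const_lt (by norm_num)
  obtain ⟨L, hL⟩ := hlim.exists
  have hclose := le_expect_poissonMixture_closeRate hT hm hm₀ hm₁₂ le_rfl hl0 hρ0.le hρ1
    fun t => (hL t).le
  have hfar := expect_poissonMixture_farRate_le (L := L) hT hε0 hε1 (by positivity) (by linarith)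
    hN (div_mul_cancel₀ _ hN0.ne') hl0 hρ0.le hρ1 (div_mul_cancel₀ _ hN0.ne')
  have hdiff := sq_expect_poissonMixture_farRate_sub_closeRate_le (L := L) T
    (by positivity : (0 : ℝ) < 10 * m) hl0 hl1 hρ0 hρ1 (total_chiSq_le hm hN hmε)
  nlinarith

theorem two_thirds_term_le_samples (hn : 2 ≤ n) (hε0 : 0 < ε) (hε1 : ε ≤ 1)
    {T : Algorithm n m₀ m₁ m₂} (hT : IsMixtureTester ε T) :
    (n : ℝ) ^ (2 / 3 : ℝ) / ε ^ (4 / 3 : ℝ) ≤ 10 ^ 6 * (m₀ + m₁ + m₂ : ℕ) := by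
  have hsqrt := sqrt_div_sq_le_samples hn hε0 hε1 hT
  obtain ⟨N, rfl⟩ : ∃ N, n = N + 1 := ⟨n - 1, by omega⟩
  have hsqrt0 : 0 < √((N + 1 : ℕ) : ℝ) / ε ^ 2 := by positivity
  have hm₀ : 1 ≤ m₀ := by exact_mod_cast (by linarith : (0 : ℝ) < m₀)
  generalize hm : m₀ + m₁ + m₂ = m
  have hm₀m : (m₀ : ℝ) ≤ m := by exact_mod_cast (by omega : m₀ ≤ m)
  refine le_of_pow_le_pow_left₀ three_ne_zero (by positivity) ?_
  rw [two_thirds_term_pow_three _ hε0]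
  have hN1 : (1 : ℝ) ≤ N := by exact_mod_cast (by omega : 1 ≤ N)
  rcases le_or_gt (1000 * (m : ℝ)) N with hmN | hNm
  · by_contra! hlt
    refine not_isMixtureTester_of_few_samples hε0.le hε1 (by omega) (by omega) (by omega) hmN ?_
      T hT
    rw [lt_div_iff₀ (by positivity)] at hlt
    push_cast at hlt
    nlinarith
  · have hsq : (√((N + 1 : ℕ) : ℝ) / ε ^ 2) ^ 2 ≤ (6 * m) ^ 2 :=
      pow_le_pow_left₀ hsqrt0.le (by linarith) 2
    rw [div_pow, Real.sq_sqrt (by positivity), ← pow_mul] at hsq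
    calc ((N + 1 : ℕ) : ℝ) ^ 2 / ε ^ 4 = ((N + 1 : ℕ) : ℝ) * (((N + 1 : ℕ) : ℝ) / ε ^ (2 * 2)) := by
          ring
      _ ≤ (2000 * (m : ℝ)) * (6 * m) ^ 2 := by
          gcongr
          push_cast
          linarith
      _ ≤ (10 ^ 6 * (m : ℝ)) ^ 3 := by
          rw [mul_pow _ _ 3]
          nlinarith [pow_pos (hm₀m.trans_lt' (by positivity)) 3]

theorem rate_le_samples (hn : 2 ≤ n) (hε0 : 0 < ε) (hε1 : ε ≤ 1) {T : Algorithm n m₀ m₁ m₂}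
    (hT : IsMixtureTester ε T) : 1 / 10 ^ 7 * rate n ε ≤ ((m₀ + m₁ + m₂ : ℕ) : ℝ) := by
  have hsqrt := sqrt_div_sq_le_samples hn hε0 hε1 hT
  have htwo_thirds := two_thirds_term_le_samples hn hε0 hε1 hT
  have hm₀ : (m₀ : ℝ) ≤ (m₀ + m₁ + m₂ : ℕ) := by exact_mod_cast (by omega : m₀ ≤ m₀ + m₁ + m₂)
  rw [rate]
  linarith

end LowerBound

end MixtureTesting

theorem mainTheorem2 :
    (∃ C : ℝ, 0 < C ∧ ∀ (n : ℕ) (ε : ℝ), 1 ≤ n → 0 < ε →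
      ∃ (m₀ m₁ m₂ : ℕ) (T : MixtureTesting.Algorithm n m₀ m₁ m₂),
        MixtureTesting.IsMixtureTester ε T ∧
        ((m₀ + m₁ + m₂ : ℕ) : ℝ) ≤ C * MixtureTesting.rate n ε) ∧
    (∃ c : ℝ, 0 < c ∧ ∀ (n : ℕ) (ε : ℝ), 2 ≤ n → 0 < ε → ε ≤ 1 →
      ∀ (m₀ m₁ m₂ : ℕ) (T : MixtureTesting.Algorithm n m₀ m₁ m₂),
        MixtureTesting.IsMixtureTester ε T →
        c * MixtureTesting.rate n ε ≤ ((m₀ + m₁ + m₂ : ℕ) : ℝ)) :=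
  ⟨MixtureTesting.exists_mixtureTester, 1 / 10 ^ 7, by norm_num,
    fun _ _ hn hε0 hε1 _ _ _ _ hT => MixtureTesting.rate_le_samples hn hε0 hε1 hT⟩
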